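/- **Setting.** Let $V,Y,\gamma$ be random variables on a probability space with $V>0$ (packet utility), $Y>0$ having a density with support $(0,\infty)$ (utility observation), and $\gamma$ the channel SNR, and let $\gamma_{\rm th}(\cdot)$ be a measurable decoding threshold with $\mathbb E[\chi(\gamma>\gamma_{\rm th}(Y))V]<\infty$. Let $\bar V(y)=\mathbb E[\chi(\gamma>\gamma_{\rm th}(Y))V\mid Y=y]$ and assume that $\bar V$ is continuous and strictly increasing on $[0,\infty)$ with $\bar V(0)=0$ and $\bar V(y)\to\infty$ as $y\to\infty$. For $x\in(0,1]$ let $y_{\rm th}(x)\ge 0$ be given by $\mathbb P(Y\ge y_{\rm th}(x))=x$, let $g(x)=\mathbb E[\chi(\gamma>\gamma_{\rm th}(Y))\,V\,\chi(Y\ge y_{\rm th}(x))]$ and $g(0)=0$; let $\lambda\ge 0$ and $z_\lambda(x)=g(x)-\lambda x$. Let $\beta\in(0,1)$ and $e_{\max}\ge 1$. In energy level $E\in\{0,\dots,e_{\max}\}$ a policy $\eta$ transmits with probability $\eta(E)$, and the next level is $\min\{E-Q+B,e_{\max}\}$ with independent $Q\sim\mathcal B(\eta(E))$, $B\sim\mathcal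 B(\beta)$; write $\mathbb P_\eta(f|e)$ for the transition probabilities. Let $\mathcal U$ be the set of policies with $\eta(0)=0$, $\eta(e)\in(0,1)$ for $0<e<e_{\max}$ and $\eta(e_{\max})\in(0,1]$. With $\xi_\eta(e)=\frac{\beta(1-\eta(e))}{(1-\beta)\eta(e)}$, let $\pi_\eta(e)=\pi_\eta(0)\big[\prod_{f=1}^{e-1}\xi_\eta(f)\big]\frac{\beta}{(1-\beta)\eta(e)}$ for $e>0$, with $\pi_\eta(0)$ fixed by normalization. Let $G(\eta)=\sum_{e\ge1}\pi_\eta(e)g(\eta(e))$, $P(\eta)=\sum_{e\ge1}\pi_\eta(e)\eta(e)$ and $Z_\lambda(\eta)=G(\eta)-\lambda P(\eta)$. Let $x^*_\lambda=\arg\max_{[0,1]}z_\lambda$, let $\eta_L\in(0,\min\{x_\lambda^*,\beta\})$ solve $g(\eta_L)+(1-\eta_L)\bar V(y_{\rm th}(\eta_L))-z_\lambda(\min\{x_\lambda^*,\beta\})/\beta=\lambda$, and let $\eta_H\in[\min\{\beta,x_\lambda^*\},x_\lambda^*]$ solve $g(\eta_H)-\eta_H\bar V(y_{\rm th}(\eta_H))-z_\lambda(\min\{x_\lambda^*,\beta\})=0$.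 **Algorithm.** Start with $\eta^{[0]}\in\mathcal U$, strictly increasing on $\{1,\dots,e_{\max}\}$ with values there in $(\eta_L,\eta_H)$. Given $\eta=\eta^{[i]}$, put $D_\eta(0)=0$ and, for $e>0$, $$D_\eta(e)=\frac{Z_\lambda(\eta)-z_\lambda(\eta(e-1))}{\beta(1-\eta(e-1))}+\frac{(1-\beta)\eta(e-1)}{\beta(1-\eta(e-1))}D_\eta(e-1),$$ and put $x(e)=\lambda+\beta D_\eta(e+1)+(1-\beta)D_\eta(e)$ for $0<e<e_{\max}$, and $x(e_{\max})=\lambda+(1-\beta)D_\eta(e_{\max})$. Let $u(e)\in(0,1]$ be the solution of $\bar V(y_{\rm th}(u(e)))=x(e)$. Then $\eta^{[i+1]}(0)=0$ and, for $e>0$, $\eta^{[i+1]}(e)$ is $u(e)$ clipped to $[\eta_L,\eta_H]$: it equals $\eta_H$ if $u(e)>\eta_H$, $\eta_L$ if $u(e)<\eta_L$, and $u(e)$ otherwise. Stop at the first $i$ with $|Z_\lambda(\eta^{[i+1]})-Z_\lambda(\eta^{[i]})|<\epsilon_{PIA}$ and return $\eta^{[i+1]}$. **Proposition.** (a) For every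 $\eta\in\mathcal U$, $\pi_\eta$ is the unique invariant distribution of the energy level. (b) For every $\eta\in\mathcal U$, the system $v(0)=0$, $v(e)-\sum_f\mathbb P_\eta(f|e)v(f)=z_\lambda(\eta(e))-Z_\lambda(\eta)$ for $e=0,\dots,e_{\max}$ has a unique solution $v_\eta$ (the relative value function), and $D_\eta(e)=v_\eta(e)-v_\eta(e-1)$ for $e>0$. (c) $x_\lambda^*,\eta_L,\eta_H$ exist and are unique, and $\eta_L<\eta_H$. (d) If $\eta\in\mathcal U$ and $\eta'$ is obtained from $\eta$ by the policy improvement step (that is, all the roots $u(e)$ exist), then, for every $e\ne 0$, $\eta'(e)$ is the unique maximizer over $a\in[\eta_L,\eta_H]$ of $z_\lambda(a)+\sum_f\mathbb P_a(f|e)v_\eta(f)$, where $\mathbb P_a(\cdot|e)$ is the transition law from level $e$ when transmitting with probability $a$. (e) There is a unique $\eta^{(\lambda)}\in\mathcal U$ with $Z_\lambda(\eta)<Z_\lambda(\eta^{(\lambda)})$ for all $\eta\in\mathcal U\setminus\{\eta^{(\lambda)}\}$. For every initial policy as above, the algorithm is well defined (all iterates lie in $\mathcal U$ and all the roots $u(e)$,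 $e\neq0$, exist and are unique); for every $\epsilon_{PIA}>0$ it stops after finitely many iterations and returns one well-determined policy; and the returned policy converges to $\eta^{(\lambda)}$ as $\epsilon_{PIA}\to0^+$. -/

import Mathlib

open MeasureTheory ProbabilityTheory Filter Topology Set

noncomputable section

/-- The reporting model of one sensor in one slot: packet utility `V`, utility observation `Y`,
channel SNR `snr`, decoding threshold `snrTh` (a function of the observation) and the expected
utility of a transmission given the observation, `Vbar y = E[1{snr > snrTh(Y)} V | Y = y]`. -/
structure SensorModel (Ω : Type*) [MeasurableSpace Ω] (μ : Measure Ω) where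
  V : Ω → ℝ
  Y : Ω → ℝ
  snr : Ω → ℝ
  snrTh : ℝ → ℝ
  Vbar : ℝ → ℝ
  measurable_V : Measurable V
  measurable_Y : Measurable Y
  measurable_snr : Measurable snr
  measurable_snrTh : Measurable snrTh
  V_pos : ∀ᵐ ω ∂μ, 0 < V ω
  Y_pos : ∀ᵐ ω ∂μ, 0 < Y ω
  /-- `Y` has a probability density. -/
  Y_absCont : μ.map Y ≪ volume
  /-- The support of the law of `Y` is the whole half line. -/
  Y_support : ∀ a b : ℝ, 0 ≤ a → a < b → 0 < μ (Y ⁻¹' Ioo a b)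
  /-- The utility delivered by a transmission (without collisions) has a finite mean. -/
  integrable_utility : Integrable (fun ω => if snrTh (Y ω) < snr ω then V ω else 0) μ
  Vbar_condExp :
    μ[fun ω => if snrTh (Y ω) < snr ω then V ω else 0 | MeasurableSpace.comap Y inferInstance]
      =ᵐ[μ] fun ω => Vbar (Y ω)
  Vbar_strictMono : StrictMonoOn Vbar (Ici 0)
  Vbar_continuous : ContinuousOn Vbar (Ici 0)
  Vbar_zero : Vbar 0 = 0
  Vbar_atTop : Tendsto Vbar atTop atTop

namespace SensorModel

variable {Ω : Type*} [MeasurableSpace Ω] {μ : Measure Ω}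

/-- The censoring threshold that gives transmission probability `x ∈ (0, 1]`, that is, the
`y ≥ 0` with `P(Y ≥ y) = x`. (For `x = 0` the threshold is `+∞`; this value is never used.) -/
def yth (m : SensorModel Ω μ) (x : ℝ) : ℝ :=
  sInf {y : ℝ | 0 ≤ y ∧ μ.real {ω | y ≤ m.Y ω} ≤ x}

/-- Expected utility of a slot in which the packet is sent exactly if `Y ≥ yth x`, without
collisions. For `x = 0` nothing is ever sent. -/
def g (m : SensorModel Ω μ) (x : ℝ) : ℝ :=
  if 0 < x then
    ∫ ω in {ω | m.yth x ≤ m.Y ω}, (if m.snrTh (m.Y ω) < m.snr ω then m.V ω else 0) ∂μ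
  else 0

def z (m : SensorModel Ω μ) (lam x : ℝ) : ℝ := m.g x - lam * x

end SensorModel

/-- A (stationary threshold) policy of a battery with capacity `N`: the transmission probability
in each energy level `0, …, N`. -/
abbrev Policy (N : ℕ) := Fin (N + 1) → ℝ

def Admissible {N : ℕ} (η : Policy N) : Prop :=
  η 0 = 0 ∧ (0 < η (Fin.last N) ∧ η (Fin.last N) ≤ 1) ∧
    ∀ e, e ≠ 0 → e ≠ Fin.last N → 0 < η e ∧ η e < 1

/-- Probability that the battery moves from level `e` to level `f` when it transmits with
probability `a`: `f = min (e - q + b) N` with independent `q ~ Bernoulli a` (transmission) and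
`b ~ Bernoulli β` (harvested quantum). -/
def battKernel {N : ℕ} (β a : ℝ) (e f : Fin (N + 1)) : ℝ :=
  ∑ q : Fin 2, ∑ b : Fin 2,
    (if q = 1 then a else 1 - a) * (if b = 1 then β else 1 - β) *
      (if (f : ℕ) = min ((e : ℕ) - (q : ℕ) + (b : ℕ)) N then 1 else 0)

/-- `p` is an invariant distribution of the energy level under the policy `η`. -/
def IsInvariantLaw {N : ℕ} (β : ℝ) (η p : Policy N) : Prop :=
  (∀ e, 0 ≤ p e) ∧ ∑ e, p e = 1 ∧ ∀ f, ∑ e, p e * battKernel β (η e) e f = p f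

/-- `ξ_η(e)`. -/
def xi {N : ℕ} (β : ℝ) (η : Policy N) (e : Fin (N + 1)) : ℝ :=
  β * (1 - η e) / ((1 - β) * η e)

/-- `π_η(e) / π_η(0)` in closed form. -/
def steadyWeight {N : ℕ} (β : ℝ) (η : Policy N) (e : Fin (N + 1)) : ℝ :=
  if e = 0 then 1 else (∏ f ∈ Finset.Ioo 0 e, xi β η f) * (β / ((1 - β) * η e))

/-- The closed form of the steady-state probability `π_η(e)`. -/
def steadyState {N : ℕ} (β : ℝ) (η : Policy N) : Policy N :=
  fun e => steadyWeight β η e / ∑ f, steadyWeight β η f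

section Algorithm

variable {Ω : Type*} [MeasurableSpace Ω] {μ : Measure Ω} {N : ℕ}

/-- Average reward `G(η)`. -/
def avgReward (m : SensorModel Ω μ) (β : ℝ) (η : Policy N) : ℝ :=
  ∑ e : Fin N, steadyState β η e.succ * m.g (η e.succ)

/-- Average transmission probability `P(η)`. -/
def avgPower (β : ℝ) (η : Policy N) : ℝ :=
  ∑ e : Fin N, steadyState β η e.succ * η e.succ

/-- `Z_λ(η) = G(η) - λ P(η)`. -/
def Z (m : SensorModel Ω μ) (β lam : ℝ) (η : Policy N) : ℝ :=
  avgReward m β η - lam * avgPower β η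

/-- `x*_λ` is a maximizer of `z_λ` on `[0, 1]`. -/
def IsXStar (m : SensorModel Ω μ) (lam xs : ℝ) : Prop :=
  xs ∈ Icc (0 : ℝ) 1 ∧ ∀ x ∈ Icc (0 : ℝ) 1, m.z lam x ≤ m.z lam xs

/-- The triple `(x*_λ, η_L(λ), η_H(λ))`. -/
def IsClipData (m : SensorModel Ω μ) (β lam xs ηL ηH : ℝ) : Prop :=
  IsXStar m lam xs ∧
  (ηL ∈ Ioo 0 (min xs β) ∧
    m.g ηL + (1 - ηL) * m.Vbar (m.yth ηL) - m.z lam (min xs β) / β = lam) ∧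
  (ηH ∈ Icc (min β xs) xs ∧
    m.g ηH - ηH * m.Vbar (m.yth ηH) - m.z lam (min xs β) = 0)

/-- `v` solves the linear system that defines the relative value function of the policy `η`. -/
def IsRelativeValue (m : SensorModel Ω μ) (β lam : ℝ) (η v : Policy N) : Prop :=
  v 0 = 0 ∧
    ∀ e, v e - ∑ f, battKernel β (η e) e f * v f = m.z lam (η e) - Z m β lam η

/-- Policy evaluation: `D_η(0) = 0` and the recursion for `D_η(e + 1)` in terms of `D_η(e)`. -/
def relDiff (m : SensorModel Ω μ) (β lam : ℝ) (η : Policy N) : Fin (N + 1) → ℝ :=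
  Fin.induction (motive := fun _ => ℝ) 0 fun e d =>
    (Z m β lam η - m.z lam (η e.castSucc)) / (β * (1 - η e.castSucc)) +
      (1 - β) * η e.castSucc / (β * (1 - η e.castSucc)) * d

/-- The right-hand side `x(e, λ)` of the root equation in the policy improvement step. -/
def rootLevel (m : SensorModel Ω μ) (β lam : ℝ) (η : Policy N) (e : Fin (N + 1)) : ℝ :=
  lam + (if h : (e : ℕ) < N then β * relDiff m β lam η ⟨e + 1, by omega⟩ else 0) +
    (1 - β) * relDiff m β lam η e

/-- `u` is a transmission probability with `Vbar (yth u) = x(e, λ)`. -/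
def IsRoot (m : SensorModel Ω μ) (β lam : ℝ) (η : Policy N) (e : Fin (N + 1)) (u : ℝ) : Prop :=
  u ∈ Ioc (0 : ℝ) 1 ∧ m.Vbar (m.yth u) = rootLevel m β lam η e

/-- Restriction of `u` to `[ηL, ηH]`. -/
def clip (ηL ηH u : ℝ) : ℝ := if ηH < u then ηH else if u < ηL then ηL else u

/-- Policy improvement: `η'` is the policy computed from `η`. -/
def Improves (m : SensorModel Ω μ) (β lam ηL ηH : ℝ) (η η' : Policy N) : Prop :=
  η' 0 = 0 ∧ ∀ e, e ≠ 0 → ∃ u, IsRoot m β lam η e u ∧ η' e = clip ηL ηH u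

/-- Admissible initial policies of the algorithm. -/
def IsInitial (ηL ηH : ℝ) (η : Policy N) : Prop :=
  Admissible η ∧ (∀ e, e ≠ 0 → η e ∈ Ioo ηL ηH) ∧ ∀ e f, e ≠ 0 → e < f → η e < η f

/-- The sequence of policies `η^[0], η^[1], …` obtained by alternating policy evaluation and
policy improvement (without the termination test). -/
def IsRun (m : SensorModel Ω μ) (β lam ηL ηH : ℝ) (η₀ : Policy N) (run : ℕ → Policy N) : Prop :=
  run 0 = η₀ ∧ ∀ i, Improves m β lam ηL ηH (run i) (run (i + 1))

/-- Started at `η₀` with tolerance `ε`, the algorithm stops and returns `out`: the termination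
test succeeds for the first time at some iteration `i`, and `out = η^[i+1]`. -/
def Returns (m : SensorModel Ω μ) (β lam ηL ηH ε : ℝ) (η₀ out : Policy N) : Prop :=
  ∃ run i, IsRun m β lam ηL ηH η₀ run ∧
    |Z m β lam (run (i + 1)) - Z m β lam (run i)| < ε ∧
    (∀ j < i, ε ≤ |Z m β lam (run (j + 1)) - Z m β lam (run j)|) ∧
    out = run (i + 1)

end Algorithm

end

/-! Censoring at y_th(a) maximizes expected utility minus s(a) times the transmission probability,
where s(a) = Vbar(y_th(a)) is `slope`. Hence s(a) is a strict supergradient of g (`g_lt_tangent`),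
and s takes every value in [0, ∞). These facts replace differentiability of g throughout.

The battery is a birth-death chain: invariance is detailed balance, and the relative-value system is
a first-order recursion for the increments of v. It yields the performance difference formula
`Z_sub_Z_eq`: Z(η') - Z(η) is the mean under π_η' of the gain in g(a) - x(e)a when a = η(e) is
replaced by η'(e).

The crux is a class preserved by improvement: monotone policies with values in [ηL, ηH] (`Regular`).
Average power is at most β, so Z ≤ z(min{x*, β}) (`Z_le`). Comparing the recursion with chords of z
to the point (β, Z) then shows that v is concave (`Regular.upDiff_le_downDiff`). So x(e) is
nonnegative and decreasing in e > 0, the roots exist, and the improved policy is again regular.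

Regular policies form a compact set, and a maximizer of Z on it is fixed by improvement. The
equations for ηL and ηH make clipping inactive at a fixed point (`Regular.slope_eq_rootLevel`),
which therefore beats every admissible policy. Each improvement closes a fixed fraction c of the gap
to the optimum (`Improves.gap_le`), so stopping at tolerance ε leaves a gap of at most ε / c;
compactness and uniqueness of the maximizer give convergence. -/

set_option linter.unusedSectionVars false

noncomputable section

/-! ### Censoring thresholds and strict concavity of the utility g -/

namespace SensorModel

variable {Ω : Type*} [MeasurableSpace Ω] {μ : Measure Ω}

/-- The tail probability `P(Y ≥ y)`. -/
def tail (m : SensorModel Ω μ) (y : ℝ) : ℝ := μ.real {ω | y ≤ m.Y ω}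

/-- The derivative of `g`: the expected utility at the censoring threshold. -/
def slope (m : SensorModel Ω μ) (x : ℝ) : ℝ := m.Vbar (m.yth x)

/-- Utility delivered by a transmission. -/
def util (m : SensorModel Ω μ) (ω : Ω) : ℝ := if m.snrTh (m.Y ω) < m.snr ω then m.V ω else 0

lemma integrable_util (m : SensorModel Ω μ) : Integrable m.util μ := m.integrable_utility

variable [IsProbabilityMeasure μ]

lemma tail_strictAntiOn (m : SensorModel Ω μ) : StrictAntiOn m.tail (Ici 0) := by
  intro a ha b hb hab
  have hpos : 0 < μ.real (m.Y ⁻¹' Ioo a b) :=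
    ENNReal.toReal_pos (m.Y_support a b ha hab).ne' (measure_ne_top _ _)
  have hdisj : Disjoint {ω | b ≤ m.Y ω} (m.Y ⁻¹' Ioo a b) := by
    rw [Set.disjoint_left]
    intro ω h1 h2
    exact absurd h2.2 (not_lt.2 h1)
  have hun := measureReal_union (μ := μ) hdisj (m.measurable_Y measurableSet_Ioo)
  have hle : μ.real ({ω | b ≤ m.Y ω} ∪ m.Y ⁻¹' Ioo a b) ≤ m.tail a := by
    refine measureReal_mono ?_ (measure_ne_top _ _)
    rintro ω (h | h)
    · exact hab.le.trans h
    · exact h.1.le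
  unfold tail at *
  linarith

lemma tail_zero (m : SensorModel Ω μ) : m.tail 0 = 1 := by
  have h : {ω | 0 ≤ m.Y ω} =ᵐ[μ] (univ : Set Ω) := by
    filter_upwards [m.Y_pos] with ω hω
    exact propext ⟨fun _ => trivial, fun _ => hω.le⟩
  rw [tail, measureReal_congr h]
  simp

lemma nullSingletonClass_map (m : SensorModel Ω μ) : NullSingletonClass (μ.map m.Y) :=
  ⟨fun x => m.Y_absCont (measure_singleton x)⟩

lemma tail_eq (m : SensorModel Ω μ) (y : ℝ) : m.tail y = 1 - cdf (μ.map m.Y) y := by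
  have := m.nullSingletonClass_map
  have : IsProbabilityMeasure (μ.map m.Y) := Measure.isProbabilityMeasure_map m.measurable_Y.aemeasurable
  rw [cdf_eq_real, ← probReal_compl_eq_one_sub measurableSet_Iic, compl_Iic,
    measureReal_congr (Ioi_ae_eq_Ici), map_measureReal_apply m.measurable_Y measurableSet_Ici]
  rfl

lemma tail_continuous (m : SensorModel Ω μ) : Continuous m.tail := by
  have := m.nullSingletonClass_map
  have : IsProbabilityMeasure (μ.map m.Y) := Measure.isProbabilityMeasure_map m.measurable_Y.aemeasurable
  -- The law of Y has no atoms, so the primitive of 1 against it is continuous.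
  have h : m.tail = fun y => m.tail 0 - ∫ _ in (0:ℝ)..y, (1:ℝ) ∂(μ.map m.Y) := by
    funext y
    rw [intervalIntegral.integral_const', tail_eq, tail_eq, cdf_eq_real, cdf_eq_real]
    have key : ∀ a b : ℝ, a ≤ b → (μ.map m.Y).real (Iic b) =
        (μ.map m.Y).real (Iic a) + (μ.map m.Y).real (Ioc a b) := by
      intro a b hab
      rw [← Iic_union_Ioc_eq_Iic hab, measureReal_union (Iic_disjoint_Ioc le_rfl) measurableSet_Ioc]
    rcases le_total 0 y with hy | hy
    · rw [key 0 y hy, Ioc_eq_empty (not_lt.2 hy)]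
      simp
      ring
    · rw [key y 0 hy, Ioc_eq_empty (not_lt.2 hy)]
      simp
      ring
  rw [h]
  exact continuous_const.sub
    (intervalIntegral.continuous_primitive (fun _ _ => intervalIntegrable_const) 0)

lemma tail_tendsto (m : SensorModel Ω μ) : Tendsto m.tail atTop (𝓝 0) := by
  have h : m.tail = fun y => 1 - cdf (μ.map m.Y) y := funext m.tail_eq
  rw [h]
  simpa using (tendsto_const_nhds (x := (1:ℝ))).sub (tendsto_cdf_atTop (μ.map m.Y))

lemma exists_tail_eq (m : SensorModel Ω μ) {x : ℝ} (hx : x ∈ Ioc (0:ℝ) 1) :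
    ∃ y, 0 ≤ y ∧ m.tail y = x := by
  obtain ⟨b, hb0, hb⟩ : ∃ b, 0 ≤ b ∧ m.tail b < x :=
    ((eventually_ge_atTop 0).and (m.tail_tendsto.eventually (gt_mem_nhds hx.1))).exists
  obtain ⟨y, hy, h⟩ := intermediate_value_Icc' hb0 m.tail_continuous.continuousOn
    ⟨hb.le, by rw [tail_zero]; exact hx.2⟩
  exact ⟨y, hy.1, h⟩

lemma tail_mem (m : SensorModel Ω μ) {y : ℝ} (hy : 0 ≤ y) : m.tail y ∈ Ioc (0:ℝ) 1 := by
  refine ⟨?_, measureReal_le_one⟩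
  have h : m.tail (y + 1) < m.tail y :=
    m.tail_strictAntiOn hy (show (0:ℝ) ≤ y + 1 by linarith) (by linarith)
  exact lt_of_le_of_lt measureReal_nonneg h

/-- The tail is strictly decreasing on [0, ∞), so the set under the infimum is the ray from y. -/
lemma yth_tail (m : SensorModel Ω μ) {y : ℝ} (hy : 0 ≤ y) : m.yth (m.tail y) = y := by
  have h : {y' : ℝ | 0 ≤ y' ∧ μ.real {ω | y' ≤ m.Y ω} ≤ m.tail y} = Ici y := by
    ext y'
    constructor
    · rintro ⟨h0, h1⟩
      exact (m.tail_strictAntiOn.le_iff_ge h0 hy).1 h1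
    · intro h1
      have h0 : (0:ℝ) ≤ y' := hy.trans h1
      exact ⟨h0, (m.tail_strictAntiOn.le_iff_ge h0 hy).2 h1⟩
  rw [yth, h, csInf_Ici]

lemma yth_spec (m : SensorModel Ω μ) {x : ℝ} (hx : x ∈ Ioc (0:ℝ) 1) :
    0 ≤ m.yth x ∧ m.tail (m.yth x) = x := by
  obtain ⟨y, hy, rfl⟩ := m.exists_tail_eq hx
  rw [m.yth_tail hy]
  exact ⟨hy, rfl⟩

lemma slope_strictAntiOn (m : SensorModel Ω μ) : StrictAntiOn m.slope (Ioc 0 1) := by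
  intro a ha b hb hab
  obtain ⟨ha0, ha1⟩ := m.yth_spec ha
  obtain ⟨hb0, hb1⟩ := m.yth_spec hb
  apply m.Vbar_strictMono hb0 ha0
  rw [← m.tail_strictAntiOn.lt_iff_gt ha0 hb0, ha1, hb1]
  exact hab

lemma slope_nonneg (m : SensorModel Ω μ) {x : ℝ} (hx : x ∈ Ioc (0:ℝ) 1) : 0 ≤ m.slope x := by
  have h := m.Vbar_strictMono.monotoneOn self_mem_Ici (m.yth_spec hx).1 (m.yth_spec hx).1
  rwa [m.Vbar_zero] at h

lemma exists_slope_eq (m : SensorModel Ω μ) {t : ℝ} (ht : 0 ≤ t) :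
    ∃ u ∈ Ioc (0:ℝ) 1, m.slope u = t := by
  obtain ⟨b, hb0, hb⟩ : ∃ b, 0 ≤ b ∧ t ≤ m.Vbar b :=
    ((eventually_ge_atTop 0).and (m.Vbar_atTop.eventually (eventually_ge_atTop t))).exists
  obtain ⟨y, hy, h⟩ := intermediate_value_Icc hb0
    (m.Vbar_continuous.mono Icc_subset_Ici_self) ⟨by rwa [m.Vbar_zero], hb⟩
  refine ⟨m.tail y, m.tail_mem hy.1, ?_⟩
  rw [slope, m.yth_tail hy.1, h]

/-- A strictly decreasing nonnegative function that attains every value in [0, ∞) cannot jump. -/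
lemma slope_continuousOn (m : SensorModel Ω μ) : ContinuousOn m.slope (Ioc 0 1) := by
  intro a ha
  refine tendsto_order.2 ⟨fun c hc => ?_, fun c hc => ?_⟩
  · rcases lt_or_ge c 0 with h0 | h0
    · filter_upwards [self_mem_nhdsWithin] with x hx
      exact h0.trans_le (m.slope_nonneg hx)
    · obtain ⟨u, hu, rfl⟩ := m.exists_slope_eq h0
      have hau := (m.slope_strictAntiOn.lt_iff_gt hu ha).1 hc
      filter_upwards [self_mem_nhdsWithin, mem_nhdsWithin_of_mem_nhds (Iio_mem_nhds hau)]
        with x hx hxu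
      exact m.slope_strictAntiOn hx hu hxu
  · obtain ⟨u, hu, rfl⟩ := m.exists_slope_eq ((m.slope_nonneg ha).trans hc.le)
    have hau := (m.slope_strictAntiOn.lt_iff_gt ha hu).1 hc
    filter_upwards [self_mem_nhdsWithin, mem_nhdsWithin_of_mem_nhds (Ioi_mem_nhds hau)]
      with x hx hxu
    exact m.slope_strictAntiOn hu hx hxu

lemma g_zero (m : SensorModel Ω μ) : m.g 0 = 0 := by simp [g]

lemma setIntegral_util (m : SensorModel Ω μ) {A : Set ℝ} (hA : MeasurableSet A) :
    ∫ ω in m.Y ⁻¹' A, m.util ω ∂μ = ∫ ω in m.Y ⁻¹' A, m.Vbar (m.Y ω) ∂μ := by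
  have hle : MeasurableSpace.comap m.Y inferInstance ≤ ‹MeasurableSpace Ω› :=
    m.measurable_Y.comap_le
  rw [← setIntegral_condExp hle m.integrable_util ⟨A, hA, rfl⟩]
  exact integral_congr_ae (ae_restrict_of_ae m.Vbar_condExp)

lemma integrable_Vbar (m : SensorModel Ω μ) : Integrable (fun ω => m.Vbar (m.Y ω)) μ :=
  integrable_condExp.congr m.Vbar_condExp

/-- Among all sets of observations, the censoring set maximizes utility minus linear cost. -/
lemma setIntegral_util_lt (m : SensorModel Ω μ) {a : ℝ} (ha : a ∈ Ioc (0:ℝ) 1) {A : Set ℝ}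
    (hA : MeasurableSet A) {c d : ℝ} (hc : 0 ≤ c) (hcd : c < d)
    (hsep : ∀ y ∈ Ioo c d, y ∈ A ↔ ¬ m.yth a ≤ y) :
    ∫ ω in m.Y ⁻¹' A, m.util ω ∂μ < m.g a + m.slope a * (μ.real (m.Y ⁻¹' A) - a) := by
  obtain ⟨hy0, hya⟩ := m.yth_spec ha
  set y := m.yth a with hy
  have hg : m.g a = ∫ ω in m.Y ⁻¹' Ici y, m.util ω ∂μ := by
    rw [g, if_pos ha.1]; rfl
  have hmA : MeasurableSet (m.Y ⁻¹' A) := m.measurable_Y hA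
  have hmI : MeasurableSet (m.Y ⁻¹' Ici y) := m.measurable_Y measurableSet_Ici
  have hint : Integrable (fun ω => m.Vbar (m.Y ω) - m.slope a) μ :=
    m.integrable_Vbar.sub (integrable_const _)
  have hval : ∀ B : Set ℝ, MeasurableSet B →
      ∫ ω, (m.Y ⁻¹' B).indicator (fun ω => m.Vbar (m.Y ω) - m.slope a) ω ∂μ =
        ∫ ω in m.Y ⁻¹' B, m.util ω ∂μ - m.slope a * μ.real (m.Y ⁻¹' B) := by
    intro B hB
    rw [integral_indicator (m.measurable_Y hB), integral_sub m.integrable_Vbar.integrableOn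
      (integrable_const _).integrableOn, m.setIntegral_util hB, setIntegral_const, smul_eq_mul,
      mul_comm]
  -- The integrand Vbar(Y) - s(a) changes sign at the threshold, so integrating it over Y ≥ y is
  -- optimal.
  have hle : ∀ᵐ ω ∂μ, (m.Y ⁻¹' A).indicator (fun ω => m.Vbar (m.Y ω) - m.slope a) ω ≤
      (m.Y ⁻¹' Ici y).indicator (fun ω => m.Vbar (m.Y ω) - m.slope a) ω := by
    filter_upwards [m.Y_pos] with ω hω
    by_cases h1 : m.Y ω ∈ Ici y
    · have h2 : 0 ≤ m.Vbar (m.Y ω) - m.slope a :=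
        sub_nonneg.2 (m.Vbar_strictMono.monotoneOn hy0 hω.le h1)
      rw [indicator_of_mem (s := m.Y ⁻¹' Ici y) h1]
      by_cases h3 : m.Y ω ∈ A
      · rw [indicator_of_mem (s := m.Y ⁻¹' A) h3]
      · rwa [indicator_of_notMem (s := m.Y ⁻¹' A) h3]
    · have h2 : m.Vbar (m.Y ω) - m.slope a ≤ 0 :=
        sub_nonpos.2 (m.Vbar_strictMono.monotoneOn hω.le hy0 (not_le.1 h1).le)
      rw [indicator_of_notMem (s := m.Y ⁻¹' Ici y) h1]
      by_cases h3 : m.Y ω ∈ A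
      · rwa [indicator_of_mem (s := m.Y ⁻¹' A) h3]
      · rw [indicator_of_notMem (s := m.Y ⁻¹' A) h3]
  have hlt : ∫ ω, (m.Y ⁻¹' A).indicator (fun ω => m.Vbar (m.Y ω) - m.slope a) ω ∂μ <
      ∫ ω, (m.Y ⁻¹' Ici y).indicator (fun ω => m.Vbar (m.Y ω) - m.slope a) ω ∂μ := by
    rw [← sub_pos, ← integral_sub (hint.indicator hmI) (hint.indicator hmA)]
    refine (integral_pos_iff_support_of_nonneg_ae
      (by filter_upwards [hle] with ω hω using sub_nonneg.2 hω)
      ((hint.indicator hmI).sub (hint.indicator hmA))).2 ?_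
    -- For observations in (c, d) the two sets are complementary, and the integrand vanishes only at
    -- y, which is dropped at no cost in measure.
    have hsub : m.Y ⁻¹' (Ioo c d \ {y}) ⊆ {ω |
        (m.Y ⁻¹' A).indicator (fun ω => m.Vbar (m.Y ω) - m.slope a) ω <
          (m.Y ⁻¹' Ici y).indicator (fun ω => m.Vbar (m.Y ω) - m.slope a) ω} := by
      rintro ω ⟨hω, hne⟩
      have hω0 : 0 ≤ m.Y ω := hc.trans hω.1.le
      have hs := hsep _ hω
      rw [mem_ofPred_eq]
      by_cases h1 : m.Y ω ∈ Ici y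
      · have h3 : m.Y ω ∉ A := fun h => hs.1 h h1
        rw [indicator_of_mem (s := m.Y ⁻¹' Ici y) h1, indicator_of_notMem (s := m.Y ⁻¹' A) h3]
        exact sub_pos.2 (m.Vbar_strictMono hy0 hω0 (lt_of_le_of_ne h1 (Ne.symm hne)))
      · have h3 : m.Y ω ∈ A := hs.2 h1
        rw [indicator_of_notMem (s := m.Y ⁻¹' Ici y) h1, indicator_of_mem (s := m.Y ⁻¹' A) h3]
        exact sub_neg.2 (m.Vbar_strictMono hω0 hy0 (not_le.1 h1))
    have hpos : μ (m.Y ⁻¹' (Ioo c d \ {y})) ≠ 0 := by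
      have := m.nullSingletonClass_map
      rw [preimage_sdiff, measure_sdiff_null]
      · exact (m.Y_support c d hc hcd).ne'
      · rw [← Measure.map_apply m.measurable_Y (measurableSet_singleton y)]
        exact measure_singleton y
    exact (pos_iff_ne_zero.2 hpos).trans_le
      (measure_mono (hsub.trans fun ω hω => (sub_pos.2 hω).ne'))
  rw [hval A hA, hval _ measurableSet_Ici, ← hg] at hlt
  have hya' : μ.real (m.Y ⁻¹' Ici y) = a := hya
  rw [hya'] at hlt
  linarith

/-- `slope a` is a strict supergradient of `g` at `a`. -/
lemma g_lt_tangent (m : SensorModel Ω μ) {a x : ℝ} (ha : a ∈ Ioc (0:ℝ) 1) (hx : x ∈ Icc (0:ℝ) 1)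
    (hne : x ≠ a) : m.g x < m.g a + m.slope a * (x - a) := by
  obtain ⟨hy0, hya⟩ := m.yth_spec ha
  rcases hx.1.eq_or_lt with rfl | hx0
  -- For x = 0 the competing set is empty; it differs from the censoring set on the unit interval
  -- above the threshold.
  · have h := m.setIntegral_util_lt ha MeasurableSet.empty hy0 (lt_add_one _)
      (fun y hy => by simp [hy.1.le])
    simpa [g_zero] using h
  · have hx' : x ∈ Ioc (0:ℝ) 1 := ⟨hx0, hx.2⟩
    obtain ⟨hx0', hxx⟩ := m.yth_spec hx'
    have hgx : m.g x = ∫ ω in m.Y ⁻¹' Ici (m.yth x), m.util ω ∂μ := by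
      rw [g, if_pos hx0]; rfl
    have hxx' : μ.real (m.Y ⁻¹' Ici (m.yth x)) = x := hxx
    have hyne : m.yth x ≠ m.yth a := fun h => hne (by rw [← hxx, ← hya, h])
    have h := fun hs => m.setIntegral_util_lt ha (measurableSet_Ici (a := m.yth x))
      (c := min (m.yth x) (m.yth a)) (d := max (m.yth x) (m.yth a)) (le_min hx0' hy0)
      (min_lt_max.2 hyne) hs
    rw [hxx', ← hgx] at h
    apply h
    rintro y ⟨h1, h2⟩
    rcases lt_or_gt_of_ne hyne with h3 | h3
    · rw [min_eq_left h3.le] at h1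
      rw [max_eq_right h3.le] at h2
      simp [h1.le, h2]
    · rw [min_eq_right h3.le] at h1
      rw [max_eq_left h3.le] at h2
      simp [h1.le, h2]

lemma g_le_tangent (m : SensorModel Ω μ) {a x : ℝ} (ha : a ∈ Ioc (0:ℝ) 1) (hx : x ∈ Icc (0:ℝ) 1) :
    m.g x ≤ m.g a + m.slope a * (x - a) := by
  rcases eq_or_ne x a with rfl | h
  · simp
  · exact (m.g_lt_tangent ha hx h).le

/-- Squeeze: the tangent at a bounds g x above, and the tangent at x, read at a, bounds it below. -/
lemma g_continuousOn (m : SensorModel Ω μ) : ContinuousOn m.g (Ioc 0 1) := by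
  intro a ha
  have hid : Tendsto (fun x : ℝ => x - a) (𝓝[Ioc 0 1] a) (𝓝 0) := by
    have h : Continuous fun x : ℝ => x - a := by fun_prop
    simpa using (h.tendsto a).mono_left nhdsWithin_le_nhds
  have h1 : Tendsto (fun x => m.g a + m.slope a * (x - a)) (𝓝[Ioc 0 1] a) (𝓝 (m.g a)) := by
    simpa using (hid.const_mul (m.slope a)).const_add (m.g a)
  have h2 : Tendsto (fun x => m.g a + m.slope x * (x - a)) (𝓝[Ioc 0 1] a) (𝓝 (m.g a)) := by
    simpa using (Tendsto.mul (m.slope_continuousOn a ha) hid).const_add (m.g a)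
  refine tendsto_of_tendsto_of_tendsto_of_le_of_le' h2 h1 ?_ ?_
  · filter_upwards [self_mem_nhdsWithin] with x hx
    linarith [m.g_le_tangent hx ⟨ha.1.le, ha.2⟩]
  · filter_upwards [self_mem_nhdsWithin] with x hx
    exact m.g_le_tangent ha ⟨hx.1.le, hx.2⟩

lemma slope_injOn (m : SensorModel Ω μ) : InjOn m.slope (Ioc 0 1) := m.slope_strictAntiOn.injOn

lemma z_zero (m : SensorModel Ω μ) (lam : ℝ) : m.z lam 0 = 0 := by simp [z, g_zero]

lemma z_le_tangent (m : SensorModel Ω μ) (lam : ℝ) {a x : ℝ} (ha : a ∈ Ioc (0:ℝ) 1)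
    (hx : x ∈ Icc (0:ℝ) 1) : m.z lam x ≤ m.z lam a + (m.slope a - lam) * (x - a) := by
  have h := m.g_le_tangent ha hx
  unfold z
  linarith

lemma z_lt_tangent (m : SensorModel Ω μ) (lam : ℝ) {a x : ℝ} (ha : a ∈ Ioc (0:ℝ) 1)
    (hx : x ∈ Icc (0:ℝ) 1) (hne : x ≠ a) :
    m.z lam x < m.z lam a + (m.slope a - lam) * (x - a) := by
  have h := m.g_lt_tangent ha hx hne
  unfold z
  linarith

end SensorModel

/-! ### The battery as a birth-death chain -/

section Chain

variable {N : ℕ}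

/-- Increment of `v` from level `e` to the next one (zero at a full battery). -/
def upDiff (v : Policy N) (e : Fin (N + 1)) : ℝ := v ⟨min (e + 1) N, by omega⟩ - v e

/-- Increment of `v` from the previous level to level `e` (zero at an empty battery). -/
def downDiff (v : Policy N) (e : Fin (N + 1)) : ℝ := v e - v ⟨e - 1, by omega⟩

lemma upDiff_castSucc (v : Policy N) (e : Fin N) :
    upDiff v e.castSucc = v e.succ - v e.castSucc := by
  unfold upDiff
  congr 2
  ext
  simp

lemma upDiff_last (v : Policy N) : upDiff v (Fin.last N) = 0 := by
  unfold upDiff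
  rw [sub_eq_zero]
  congr 1
  ext
  simp

lemma downDiff_succ (v : Policy N) (e : Fin N) :
    downDiff v e.succ = v e.succ - v e.castSucc := by
  unfold downDiff
  congr 2

lemma downDiff_zero (v : Policy N) : downDiff v 0 = 0 := by
  unfold downDiff
  rw [sub_eq_zero]
  congr 1

lemma sum_mul_ite_val_eq (v : Policy N) (c : ℝ) (k : ℕ) (hk : k < N + 1) :
    ∑ f : Fin (N + 1), c * (if (f : ℕ) = k then 1 else 0) * v f = c * v ⟨k, hk⟩ := by
  rw [Finset.sum_eq_single ⟨k, hk⟩]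
  · simp
  · intro b _ hb
    rw [if_neg (fun h => hb (Fin.ext h))]
    simp
  · simp

/-- The expected value after one transition. -/
lemma sum_battKernel_mul (β a : ℝ) (e : Fin (N + 1)) (v : Policy N) (h : e ≠ 0 ∨ a = 0) :
    ∑ f, battKernel β a e f * v f =
      v e + β * (1 - a) * upDiff v e - (1 - β) * a * downDiff v e := by
  unfold battKernel
  simp only [Fin.sum_univ_two, add_mul, Finset.sum_add_distrib]
  rw [sum_mul_ite_val_eq _ _ _ (by omega), sum_mul_ite_val_eq _ _ _ (by omega),
    sum_mul_ite_val_eq _ _ _ (by omega), sum_mul_ite_val_eq _ _ _ (by omega)]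
  have h1 : (⟨min ((e : ℕ) - ((0 : Fin 2) : ℕ) + ((0 : Fin 2) : ℕ)) N, by omega⟩ : Fin (N + 1)) = e := by
    ext; simp; omega
  have h2 : (⟨min ((e : ℕ) - ((1 : Fin 2) : ℕ) + ((0 : Fin 2) : ℕ)) N, by omega⟩ : Fin (N + 1)) =
      ⟨e - 1, by omega⟩ := by
    ext; simp
  have h3 : (⟨min ((e : ℕ) - ((0 : Fin 2) : ℕ) + ((1 : Fin 2) : ℕ)) N, by omega⟩ : Fin (N + 1)) =
      ⟨min (e + 1) N, by omega⟩ := by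
    ext; simp
  rw [h1, h2, h3]
  unfold upDiff downDiff
  rcases h with h | h
  · have h4 : (⟨min ((e : ℕ) - ((1 : Fin 2) : ℕ) + ((1 : Fin 2) : ℕ)) N, by omega⟩ : Fin (N + 1)) =
        e := by
      have : (e : ℕ) ≠ 0 := fun h' => h (Fin.ext h')
      ext; simp; omega
    rw [h4]
    simp
    ring
  · subst h
    simp
    ring

/-- Detailed balance of the energy level under the policy `η`. -/
def DetailedBalance (β : ℝ) (η p : Policy N) : Prop :=
  ∀ k : Fin N, p k.castSucc * (β * (1 - η k.castSucc)) = p k.succ * ((1 - β) * η k.succ)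

/-- Summation by parts for one step of the chain. -/
lemma sum_mul_sum_battKernel (β : ℝ) (η p v : Policy N) (h0 : η 0 = 0) :
    ∑ e, p e * ∑ f, battKernel β (η e) e f * v f = ∑ e, p e * v e +
      ∑ k : Fin N, (p k.castSucc * (β * (1 - η k.castSucc)) - p k.succ * ((1 - β) * η k.succ)) *
        (v k.succ - v k.castSucc) := by
  have h1 : ∀ e, p e * ∑ f, battKernel β (η e) e f * v f =
      p e * v e + p e * (β * (1 - η e)) * upDiff v e - p e * ((1 - β) * η e) * downDiff v e := by
    intro e
    rw [sum_battKernel_mul]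
    · ring
    · by_cases h : e = 0
      · right; rw [h, h0]
      · exact Or.inl h
  have h2 : ∀ k : Fin N, (p k.castSucc * (β * (1 - η k.castSucc)) -
      p k.succ * ((1 - β) * η k.succ)) * (v k.succ - v k.castSucc) =
      p k.castSucc * (β * (1 - η k.castSucc)) * (v k.succ - v k.castSucc) -
      p k.succ * ((1 - β) * η k.succ) * (v k.succ - v k.castSucc) := fun k => sub_mul _ _ _
  simp only [h1, h2, Finset.sum_add_distrib, Finset.sum_sub_distrib]
  rw [Fin.sum_univ_castSucc (f := fun e => p e * (β * (1 - η e)) * upDiff v e),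
    Fin.sum_univ_succ (f := fun e => p e * ((1 - β) * η e) * downDiff v e)]
  simp only [upDiff_castSucc, upDiff_last, downDiff_succ, downDiff_zero]
  ring

lemma sum_sum_battKernel_of_invariant {β : ℝ} {η p : Policy N}
    (h : ∀ f, ∑ e, p e * battKernel β (η e) e f = p f) (v : Policy N) :
    ∑ e, p e * ∑ f, battKernel β (η e) e f * v f = ∑ e, p e * v e := by
  simp only [Finset.mul_sum]
  rw [Finset.sum_comm]
  refine Finset.sum_congr rfl fun f _ => ?_
  rw [← h f, Finset.sum_mul]
  exact Finset.sum_congr rfl fun e _ => by ring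

lemma invariant_iff_detailedBalance (β : ℝ) (η p : Policy N) (h0 : η 0 = 0) :
    (∀ f, ∑ e, p e * battKernel β (η e) e f = p f) ↔ DetailedBalance β η p := by
  constructor
  · intro h k
    -- Testing against the indicator of the levels above k isolates the flow across the cut between
    -- k and k + 1: all other increments of the test function vanish.
    have h1 := sum_sum_battKernel_of_invariant h (fun f => if k.castSucc < f then 1 else 0)
    rw [sum_mul_sum_battKernel _ _ _ _ h0, add_eq_left] at h1
    rw [Finset.sum_eq_single k] at h1
    · simpa [sub_eq_zero] using h1
    · intro j _ hj
      have h2 : (k.castSucc < j.succ) ↔ (k.castSucc < j.castSucc) := by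
        have : (j : ℕ) ≠ k := fun h => hj (Fin.ext h)
        simp only [Fin.lt_def, Fin.val_castSucc, Fin.val_succ]
        omega
      simp only [h2]
      simp
    · simp
  · intro h f
    have h1 := sum_mul_sum_battKernel β η p (Pi.single f 1) h0
    rw [Finset.sum_eq_zero (s := (Finset.univ : Finset (Fin N)))] at h1
    · simpa [Pi.single_apply] using h1
    · intro k _
      rw [sub_eq_zero.2 (h k), zero_mul]

section Admissible

variable {β : ℝ} {η : Policy N}

lemma Admissible.pos (h : Admissible η) {e : Fin (N + 1)} (he : e ≠ 0) : 0 < η e := by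
  by_cases hl : e = Fin.last N
  · rw [hl]; exact h.2.1.1
  · exact (h.2.2 e he hl).1

lemma Admissible.le_one (h : Admissible η) (e : Fin (N + 1)) : η e ≤ 1 := by
  by_cases he : e = 0
  · rw [he, h.1]; exact zero_le_one
  by_cases hl : e = Fin.last N
  · rw [hl]; exact h.2.1.2
  · exact (h.2.2 e he hl).2.le

lemma Admissible.nonneg (h : Admissible η) (e : Fin (N + 1)) : 0 ≤ η e := by
  by_cases he : e = 0
  · rw [he, h.1]
  · exact (h.pos he).le

lemma Admissible.mem_Icc (h : Admissible η) (e : Fin (N + 1)) : η e ∈ Icc (0:ℝ) 1 :=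
  ⟨h.nonneg e, h.le_one e⟩

lemma Admissible.lt_one (h : Admissible η) (e : Fin N) : η e.castSucc < 1 := by
  by_cases he : e.castSucc = 0
  · rw [he, h.1]; exact zero_lt_one
  · exact (h.2.2 _ he (Fin.castSucc_ne_last e)).2

lemma steadyWeight_pos (hβ0 : 0 < β) (hβ1 : β < 1) (h : Admissible η) (e : Fin (N + 1)) :
    0 < steadyWeight β η e := by
  have hb : 0 < 1 - β := sub_pos.2 hβ1
  unfold steadyWeight
  split_ifs with he
  · exact one_pos
  · refine mul_pos (Finset.prod_pos fun f hf => ?_) (div_pos hβ0 (mul_pos hb (h.pos he)))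
    rw [Finset.mem_Ioo] at hf
    obtain ⟨h1, h2⟩ := h.2.2 f hf.1.ne' (hf.2.trans_le (Fin.le_last e)).ne
    exact div_pos (mul_pos hβ0 (sub_pos.2 h2)) (mul_pos hb h1)

lemma steadyWeight_detailedBalance (hβ1 : β < 1) (h : Admissible η) :
    DetailedBalance β η (steadyWeight β η) := by
  intro k
  have hb : (1 - β) ≠ 0 := (sub_pos.2 hβ1).ne'
  have hs : η k.succ ≠ 0 := (h.pos (Fin.succ_ne_zero k)).ne'
  have h1 : steadyWeight β η k.succ * ((1 - β) * η k.succ) =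
      (∏ f ∈ Finset.Ioo 0 k.succ, xi β η f) * β := by
    rw [steadyWeight, if_neg (Fin.succ_ne_zero k)]
    field_simp
  rw [h1]
  by_cases hk : k.castSucc = 0
  · have h2 : Finset.Ioo 0 k.succ = ∅ := by
      ext f
      have := congrArg Fin.val hk
      simp only [Finset.mem_Ioo, Fin.lt_def, Fin.val_succ, Finset.notMem_empty, iff_false]
      simp only [Fin.val_castSucc, Fin.val_zero] at this ⊢
      omega
    rw [h2, hk, steadyWeight, if_pos rfl, h.1]
    simp
  · have h2 : Finset.Ioo 0 k.succ = insert k.castSucc (Finset.Ioo 0 k.castSucc) := by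
      ext f
      have h3 : (k : ℕ) ≠ 0 := fun h => hk (Fin.ext h)
      simp only [Finset.mem_Ioo, Finset.mem_insert, Fin.lt_def, Fin.ext_iff, Fin.val_succ,
        Fin.val_castSucc, Fin.val_zero]
      omega
    have hc : η k.castSucc ≠ 0 := (h.pos hk).ne'
    rw [h2, Finset.prod_insert (by simp), steadyWeight, if_neg hk, xi]
    field_simp

lemma sum_steadyWeight_pos (hβ0 : 0 < β) (hβ1 : β < 1) (h : Admissible η) :
    0 < ∑ e, steadyWeight β η e :=
  Finset.sum_pos (fun e _ => steadyWeight_pos hβ0 hβ1 h e) Finset.univ_nonempty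

lemma steadyState_pos (hβ0 : 0 < β) (hβ1 : β < 1) (h : Admissible η) (e : Fin (N + 1)) :
    0 < steadyState β η e :=
  div_pos (steadyWeight_pos hβ0 hβ1 h e) (sum_steadyWeight_pos hβ0 hβ1 h)

lemma sum_steadyState (hβ0 : 0 < β) (hβ1 : β < 1) (h : Admissible η) :
    ∑ e, steadyState β η e = 1 := by
  unfold steadyState
  rw [← Finset.sum_div, div_self (sum_steadyWeight_pos hβ0 hβ1 h).ne']

lemma steadyState_le_one (hβ0 : 0 < β) (hβ1 : β < 1) (h : Admissible η) (e : Fin (N + 1)) :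
    steadyState β η e ≤ 1 := by
  rw [← sum_steadyState hβ0 hβ1 h]
  exact Finset.single_le_sum (fun f _ => (steadyState_pos hβ0 hβ1 h f).le) (Finset.mem_univ e)

lemma steadyState_detailedBalance (hβ1 : β < 1) (h : Admissible η) :
    DetailedBalance β η (steadyState β η) := by
  intro k
  unfold steadyState
  rw [div_mul_eq_mul_div, div_mul_eq_mul_div, steadyWeight_detailedBalance hβ1 h k]

lemma steadyState_invariant (hβ1 : β < 1) (h : Admissible η) (f : Fin (N + 1)) :
    ∑ e, steadyState β η e * battKernel β (η e) e f = steadyState β η f :=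
  (invariant_iff_detailedBalance β η _ h.1).2 (steadyState_detailedBalance hβ1 h) f

lemma DetailedBalance.eq_mul_steadyWeight (hβ1 : β < 1) (h : Admissible η) {p : Policy N}
    (hp : DetailedBalance β η p) (e : Fin (N + 1)) : p e = p 0 * steadyWeight β η e := by
  induction e using Fin.induction with
  | zero => simp [steadyWeight]
  | succ k ih =>
    have h1 := hp k
    have h2 := steadyWeight_detailedBalance hβ1 h k
    have h3 : (1 - β) * η k.succ ≠ 0 :=
      (mul_pos (sub_pos.2 hβ1) (h.pos (Fin.succ_ne_zero k))).ne'
    apply mul_right_cancel₀ h3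
    rw [← h1, ih, mul_assoc, mul_assoc, h2]

theorem isInvariantLaw_iff (hβ0 : 0 < β) (hβ1 : β < 1) (h : Admissible η) (p : Policy N) :
    IsInvariantLaw β η p ↔ p = steadyState β η := by
  constructor
  · rintro ⟨-, hsum, hinv⟩
    have hdb := (invariant_iff_detailedBalance β η p h.1).1 hinv
    have he := hdb.eq_mul_steadyWeight hβ1 h
    have h1 : p 0 * ∑ e, steadyWeight β η e = 1 := by
      rw [← hsum, Finset.mul_sum]
      exact Finset.sum_congr rfl fun e _ => (he e).symm
    funext e
    rw [he e, steadyState, eq_div_iff (sum_steadyWeight_pos hβ0 hβ1 h).ne']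
    linear_combination steadyWeight β η e * h1
  · rintro rfl
    exact ⟨fun e => (steadyState_pos hβ0 hβ1 h e).le, sum_steadyState hβ0 hβ1 h,
      steadyState_invariant hβ1 h⟩

lemma avgPower_eq (h : Admissible η) : avgPower β η = ∑ e, steadyState β η e * η e := by
  rw [Fin.sum_univ_succ, h.1, mul_zero, zero_add, avgPower]

/-- On average no more energy is spent than harvested. -/
lemma avgPower_le (hβ0 : 0 < β) (hβ1 : β < 1) (h : Admissible η) : avgPower β η ≤ β := by
  have h1 : ∑ k : Fin N, steadyState β η k.castSucc * (β * (1 - η k.castSucc)) =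
      ∑ k : Fin N, steadyState β η k.succ * ((1 - β) * η k.succ) :=
    Finset.sum_congr rfl fun k _ => steadyState_detailedBalance hβ1 h k
  have h2 : ∑ k : Fin N, steadyState β η k.succ * ((1 - β) * η k.succ) =
      (1 - β) * avgPower β η := by
    rw [avgPower, Finset.mul_sum]
    exact Finset.sum_congr rfl fun k _ => by ring
  have h3 : ∑ e, steadyState β η e * (β * (1 - η e)) = β - β * avgPower β η := by
    have h4 : ∀ e, steadyState β η e * (β * (1 - η e)) =
        β * steadyState β η e - β * (steadyState β η e * η e) := fun e => by ring
    simp only [h4]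
    rw [Finset.sum_sub_distrib, ← Finset.mul_sum, ← Finset.mul_sum, ← avgPower_eq h,
      sum_steadyState hβ0 hβ1 h, mul_one]
  rw [Fin.sum_univ_castSucc, h1, h2] at h3
  -- This term is the harvested energy lost at a full battery.
  have h5 : 0 ≤ steadyState β η (Fin.last N) * (β * (1 - η (Fin.last N))) :=
    mul_nonneg (steadyState_pos hβ0 hβ1 h _).le (mul_nonneg hβ0.le (sub_nonneg.2 (h.le_one _)))
  linarith

end Admissible

end Chain

/-! ### Relative values and the performance difference formula -/

section RelativeValue

variable {Ω : Type*} [MeasurableSpace Ω] {μ : Measure Ω} [IsProbabilityMeasure μ] {N : ℕ}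
  (m : SensorModel Ω μ) {β lam : ℝ} {η η' v : Policy N}

lemma Z_eq_sum (h : Admissible η) : Z m β lam η = ∑ e, steadyState β η e * m.z lam (η e) := by
  rw [Fin.sum_univ_succ, h.1, m.z_zero, mul_zero, zero_add, Z, avgReward, avgPower,
    Finset.mul_sum, ← Finset.sum_sub_distrib]
  refine Finset.sum_congr rfl fun e _ => ?_
  rw [SensorModel.z]
  ring

lemma isRelativeValue_iff (h : Admissible η) : IsRelativeValue m β lam η v ↔ v 0 = 0 ∧
    ∀ e, β * (1 - η e) * upDiff v e =
      Z m β lam η - m.z lam (η e) + (1 - β) * η e * downDiff v e := by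
  refine and_congr_right fun _ => forall_congr' fun e => ?_
  rw [sum_battKernel_mul]
  · constructor <;> intro h <;> linarith
  · by_cases he : e = 0
    · right; rw [he, h.1]
    · exact Or.inl he

lemma IsRelativeValue.relDiff_eq (hβ0 : 0 < β) (h : Admissible η)
    (hv : IsRelativeValue m β lam η v) (e : Fin (N + 1)) :
    relDiff m β lam η e = downDiff v e := by
  induction e using Fin.induction with
  | zero => rw [downDiff_zero]; rfl
  | succ k ih =>
    have h1 := ((isRelativeValue_iff m h).1 hv).2 k.castSucc
    have h2 : 1 - η k.castSucc ≠ 0 := (sub_pos.2 (h.lt_one k)).ne'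
    have h3 : relDiff m β lam η k.succ =
      (Z m β lam η - m.z lam (η k.castSucc)) / (β * (1 - η k.castSucc)) +
      (1 - β) * η k.castSucc / (β * (1 - η k.castSucc)) * relDiff m β lam η k.castSucc := rfl
    rw [h3, ih, downDiff_succ, ← upDiff_castSucc]
    have h4 := hβ0.ne'
    field_simp
    linarith

lemma eq_of_downDiff_eq {v w : Policy N} (h0 : v 0 = w 0)
    (h : ∀ e : Fin N, downDiff v e.succ = downDiff w e.succ) : v = w := by
  funext e
  induction e using Fin.induction with
  | zero => exact h0
  | succ k ih =>
    have h1 := h k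
    rw [downDiff_succ, downDiff_succ] at h1
    linarith

/-- Partial sums of the increments computed in the policy evaluation step. -/
def relValue (m : SensorModel Ω μ) (β lam : ℝ) (η : Policy N) : Policy N :=
  Fin.induction (motive := fun _ => ℝ) 0 fun e s => s + relDiff m β lam η e.succ

lemma downDiff_relValue (e : Fin (N + 1)) :
    downDiff (relValue m β lam η) e = relDiff m β lam η e := by
  cases e using Fin.cases with
  | zero => rw [downDiff_zero]; rfl
  | succ k =>
    rw [downDiff_succ]
    have h : relValue m β lam η k.succ =
      relValue m β lam η k.castSucc + relDiff m β lam η k.succ := rfl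
    rw [h]
    ring

lemma isRelativeValue_relValue (hβ0 : 0 < β) (hβ1 : β < 1) (h : Admissible η) :
    IsRelativeValue m β lam η (relValue m β lam η) := by
  set v := relValue m β lam η with hv
  have h1 : ∀ k : Fin N, v k.castSucc - ∑ f, battKernel β (η k.castSucc) k.castSucc f * v f -
      (m.z lam (η k.castSucc) - Z m β lam η) = 0 := by
    intro k
    rw [sum_battKernel_mul]
    · have h2 : 1 - η k.castSucc ≠ 0 := (sub_pos.2 (h.lt_one k)).ne'
      have h3 : relDiff m β lam η k.succ =
        (Z m β lam η - m.z lam (η k.castSucc)) / (β * (1 - η k.castSucc)) +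
        (1 - β) * η k.castSucc / (β * (1 - η k.castSucc)) * relDiff m β lam η k.castSucc := rfl
      rw [upDiff_castSucc, ← downDiff_succ, downDiff_relValue, downDiff_relValue, h3]
      have h4 := hβ0.ne'
      field_simp
      ring
    · by_cases he : k.castSucc = 0
      · right; rw [he, h.1]
      · exact Or.inl he
  refine ⟨rfl, fun e => ?_⟩
  rw [← sub_eq_zero]
  cases e using Fin.lastCases with
  | cast k => exact h1 k
  | last =>
    -- The recursion leaves out the equation at the full battery. Averaged over the invariant law
    -- all residuals sum to zero, and the last level has positive mass, so its residual vanishes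
    -- too.
    have hs : ∑ e, steadyState β η e * (v e - ∑ f, battKernel β (η e) e f * v f -
        (m.z lam (η e) - Z m β lam η)) = 0 := by
      have h2 : ∀ e, steadyState β η e * (v e - ∑ f, battKernel β (η e) e f * v f -
          (m.z lam (η e) - Z m β lam η)) = steadyState β η e * v e -
          steadyState β η e * ∑ f, battKernel β (η e) e f * v f -
          steadyState β η e * m.z lam (η e) + steadyState β η e * Z m β lam η :=
        fun e => by ring
      simp only [h2, Finset.sum_add_distrib, Finset.sum_sub_distrib]
      rw [sum_sum_battKernel_of_invariant (steadyState_invariant hβ1 h), ← Z_eq_sum m h,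
        ← Finset.sum_mul, sum_steadyState hβ0 hβ1 h]
      ring
    rw [Fin.sum_univ_castSucc, Finset.sum_eq_zero (fun k _ => by rw [h1 k, mul_zero]),
      zero_add] at hs
    exact (mul_eq_zero.1 hs).resolve_left (steadyState_pos hβ0 hβ1 h _).ne'

theorem exists_isRelativeValue (hβ0 : 0 < β) (hβ1 : β < 1) (h : Admissible η) :
    ∃ v, IsRelativeValue m β lam η v ∧ (∀ w, IsRelativeValue m β lam η w → w = v) ∧
      ∀ e : Fin N, relDiff m β lam η e.succ = v e.succ - v e.castSucc := by
  have hv := isRelativeValue_relValue m (lam := lam) hβ0 hβ1 h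
  refine ⟨_, hv, fun w hw => ?_, fun e => ?_⟩
  · refine eq_of_downDiff_eq (hw.1.trans hv.1.symm) fun e => ?_
    rw [← hw.relDiff_eq m hβ0 h, downDiff_relValue]
  · rw [← downDiff_succ, downDiff_relValue]

lemma IsRelativeValue.rootLevel_eq (hβ0 : 0 < β) (h : Admissible η)
    (hv : IsRelativeValue m β lam η v) (e : Fin (N + 1)) :
    rootLevel m β lam η e = lam + β * upDiff v e + (1 - β) * downDiff v e := by
  unfold rootLevel
  rw [hv.relDiff_eq m hβ0 h]
  congr 2
  -- At a full battery the term missing from `rootLevel` matches a zero upward increment.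
  cases e using Fin.lastCases with
  | last => rw [dif_neg (by simp), upDiff_last, mul_zero]
  | cast k =>
    have hk : ((k.castSucc : Fin (N + 1)) : ℕ) < N := k.2
    rw [dif_pos hk, hv.relDiff_eq m hβ0 h, upDiff_castSucc, ← downDiff_succ]
    rfl

/-- The one-step look-ahead value in terms of the right-hand side of the root equation. -/
lemma IsRelativeValue.lookAhead_eq (hβ0 : 0 < β) (h : Admissible η)
    (hv : IsRelativeValue m β lam η v) {e : Fin (N + 1)} {a : ℝ} (ha : e ≠ 0 ∨ a = 0) :
    m.z lam a + ∑ f, battKernel β a e f * v f =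
      v e + β * upDiff v e + (m.g a - rootLevel m β lam η e * a) := by
  rw [sum_battKernel_mul _ _ _ _ ha, hv.rootLevel_eq m hβ0 h, SensorModel.z]
  ring

/-- Performance difference between two policies. -/
lemma Z_sub_Z_eq (hβ0 : 0 < β) (hβ1 : β < 1) (h : Admissible η) (h' : Admissible η') :
    Z m β lam η' - Z m β lam η = ∑ e, steadyState β η' e *
      ((m.g (η' e) - rootLevel m β lam η e * η' e) -
        (m.g (η e) - rootLevel m β lam η e * η e)) := by
  have hv := isRelativeValue_relValue m (lam := lam) hβ0 hβ1 h
  set v := relValue m β lam η with hvdef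
  have hor : ∀ {η : Policy N}, Admissible η → ∀ e, e ≠ 0 ∨ η e = 0 := by
    intro η h e
    by_cases he : e = 0
    · right; rw [he, h.1]
    · exact Or.inl he
  -- The look-ahead value of η itself is v(e) + Z(η); invariance of π_η' then cancels the terms in
  -- v.
  have h1 : ∀ e, steadyState β η' e * ((m.g (η' e) - rootLevel m β lam η e * η' e) -
        (m.g (η e) - rootLevel m β lam η e * η e)) = steadyState β η' e * m.z lam (η' e) +
        steadyState β η' e * ∑ f, battKernel β (η' e) e f * v f -
        steadyState β η' e * v e - steadyState β η' e * Z m β lam η := by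
    intro e
    have h2 := hv.lookAhead_eq m hβ0 h (hor h e)
    have h3 := hv.lookAhead_eq m hβ0 h (hor h' e)
    have h4 := hv.2 e
    linear_combination (-steadyState β η' e) * h3 + steadyState β η' e * h2 +
      steadyState β η' e * h4
  simp only [h1, Finset.sum_add_distrib, Finset.sum_sub_distrib]
  rw [sum_sum_battKernel_of_invariant (steadyState_invariant hβ1 h'), ← Z_eq_sum m h',
    ← Finset.sum_mul, sum_steadyState hβ0 hβ1 h']
  ring

end RelativeValue

/-! ### The maximizer of z and the clipping bounds -/

section ClipData

variable {Ω : Type*} [MeasurableSpace Ω] {μ : Measure Ω} [IsProbabilityMeasure μ]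
  (m : SensorModel Ω μ) {β lam xs ηL ηH : ℝ}

/-- A stationary point is the strict maximizer by concavity, and one exists for every λ ≥ 0, so no
boundary case arises. -/
lemma isXStar_iff (hlam : 0 ≤ lam) : IsXStar m lam xs ↔ xs ∈ Ioc (0:ℝ) 1 ∧ m.slope xs = lam := by
  have key : ∀ x ∈ Ioc (0:ℝ) 1, m.slope x = lam → ∀ y ∈ Icc (0:ℝ) 1, y ≠ x →
      m.z lam y < m.z lam x := by
    intro x hx hs y hy hne
    simpa [hs] using m.z_lt_tangent lam hx hy hne
  constructor
  · rintro ⟨h1, h2⟩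
    obtain ⟨x, hx, hs⟩ := m.exists_slope_eq hlam
    by_cases h : xs = x
    · rw [h]; exact ⟨hx, hs⟩
    · exact absurd (h2 x ⟨hx.1.le, hx.2⟩) (not_le.2 (key x hx hs xs h1 h))
  · rintro ⟨h1, h2⟩
    refine ⟨⟨h1.1.le, h1.2⟩, fun y hy => ?_⟩
    by_cases h : y = xs
    · rw [h]
    · exact (key xs h1 h2 y hy h).le

/-- This is the height at 1 of the tangent to g at a, as in the equation for ηL; by concavity it
falls as a moves right. The next lemma treats the height at 0, as in the equation for ηH. -/
lemma tangent_at_one_strictAntiOn :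
    StrictAntiOn (fun a => m.g a + (1 - a) * m.slope a) (Ioc 0 1) := by
  intro a ha b hb hab
  have h1 := m.g_lt_tangent ha ⟨hb.1.le, hb.2⟩ hab.ne'
  have h2 := mul_le_mul_of_nonneg_left (m.slope_strictAntiOn ha hb hab).le (sub_nonneg.2 hb.2)
  show m.g b + (1 - b) * m.slope b < m.g a + (1 - a) * m.slope a
  linarith

lemma tangent_at_zero_strictMonoOn :
    StrictMonoOn (fun a => m.g a - a * m.slope a) (Ioc 0 1) := by
  intro a ha b hb hab
  have h1 := m.g_lt_tangent hb ⟨ha.1.le, ha.2⟩ hab.ne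
  have h2 := mul_le_mul_of_nonneg_left (m.slope_strictAntiOn ha hb hab).le ha.1.le
  show m.g a - a * m.slope a < m.g b - b * m.slope b
  linarith

lemma mul_slope_le_g {a : ℝ} (ha : a ∈ Ioc (0:ℝ) 1) : a * m.slope a ≤ m.g a := by
  have h := m.g_le_tangent ha (left_mem_Icc.2 zero_le_one)
  rw [m.g_zero] at h
  linarith

lemma min_mem_Ioc (hβ0 : 0 < β) (hxs : xs ∈ Ioc (0:ℝ) 1) : min xs β ∈ Ioc (0:ℝ) 1 :=
  ⟨lt_min hxs.1 hβ0, (min_le_left _ _).trans hxs.2⟩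

lemma slope_min_sub_nonneg (hβ0 : 0 < β) (hxs : xs ∈ Ioc (0:ℝ) 1) (hs : m.slope xs = lam) :
    0 ≤ m.slope (min xs β) - lam := by
  rw [← hs, sub_nonneg]
  exact m.slope_strictAntiOn.antitoneOn (min_mem_Ioc hβ0 hxs) hxs (min_le_left _ _)

/-- Complementary slackness: either x* ≤ β and the multiplier is zero, or the minimum is β. -/
lemma slope_min_sub_mul (hs : m.slope xs = lam) :
    (m.slope (min xs β) - lam) * min xs β = (m.slope (min xs β) - lam) * β := by
  rcases le_total xs β with h | h
  · rw [min_eq_left h, hs]; simp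
  · rw [min_eq_right h]

lemma exists_isClipData (hβ0 : 0 < β) (hβ1 : β < 1) (hlam : 0 ≤ lam) :
    ∃ xs ηL ηH, IsClipData m β lam xs ηL ηH := by
  obtain ⟨xs, hxs, hs⟩ := m.exists_slope_eq hlam
  have hx := min_mem_Ioc hβ0 hxs
  have hs0 := slope_min_sub_nonneg m hβ0 hxs hs
  have hsm := slope_min_sub_mul m (β := β) hs
  set x := min xs β with hxdef
  -- The tangent to z at x lies strictly above z(0) = 0 at the origin; slackness replaces x by β.
  have hz : (m.slope x - lam) * β < m.z lam x := by
    have h := m.z_lt_tangent lam hx (left_mem_Icc.2 zero_le_one) hx.1.ne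
    rw [m.z_zero] at h
    linarith
  have hphi : m.g x + (1 - x) * m.slope x < lam + m.z lam x / β := by
    have h1 : (m.slope x - lam) * (1 - β) < m.z lam x / β - m.z lam x := by
      have h2 : m.z lam x / β - m.z lam x = m.z lam x / β * (1 - β) := by
        field_simp
      rw [h2]
      exact mul_lt_mul_of_pos_right ((lt_div_iff₀ hβ0).2 hz) (sub_pos.2 hβ1)
    have h3 : m.z lam x = m.g x - lam * x := rfl
    linarith
  have hg := m.g_continuousOn
  have hsl := m.slope_continuousOn
  -- The slope at u exceeds the slope at x, which puts u left of x, and is at least the target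
  -- value; the tangent height at 1 is at least the slope because g(u) ≥ u s(u).
  obtain ⟨u, hu, hut⟩ := m.exists_slope_eq
    (t := max (m.slope x + 1) (lam + m.z lam x / β))
    (le_max_of_le_left (add_nonneg (m.slope_nonneg hx) zero_le_one))
  have hux : u < x := by
    rw [← m.slope_strictAntiOn.lt_iff_gt hx hu, hut]
    exact lt_max_of_lt_left (lt_add_one _)
  have hphiu : lam + m.z lam x / β ≤ m.g u + (1 - u) * m.slope u := by
    have h1 := mul_slope_le_g m hu
    have h2 : lam + m.z lam x / β ≤ m.slope u := by rw [hut]; exact le_max_right _ _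
    linarith
  have hsub : Icc u x ⊆ Ioc 0 1 := fun y hy => ⟨hu.1.trans_le hy.1, hy.2.trans hx.2⟩
  have hcont : ContinuousOn (fun a => m.g a + (1 - a) * m.slope a) (Ioc 0 1) :=
    hg.add ((continuousOn_const.sub continuousOn_id).mul hsl)
  obtain ⟨ηL, hL, hLe⟩ := intermediate_value_Icc' hux.le (hcont.mono hsub) ⟨hphi.le, hphiu⟩
  have hLe' : m.g ηL + (1 - ηL) * m.slope ηL = lam + m.z lam x / β := hLe
  have hLx : ηL < x := by
    refine lt_of_le_of_ne hL.2 fun h => ?_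
    rw [h] at hLe'
    exact hphi.ne hLe'
  have hsub' : Icc x xs ⊆ Ioc 0 1 := fun y hy => ⟨hx.1.trans_le hy.1, hy.2.trans hxs.2⟩
  have hcont' : ContinuousOn (fun a => m.g a - a * m.slope a) (Ioc 0 1) :=
    hg.sub (continuousOn_id.mul hsl)
  have hxxs : x ≤ xs := min_le_left _ _
  -- At x the tangent height at 0 is z(x) minus a nonnegative amount; at x* it is z(x*), since the
  -- slope there is λ.
  obtain ⟨ηH, hH, hHe⟩ := intermediate_value_Icc hxxs (hcont'.mono hsub')
    (show m.z lam x ∈ _ from by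
      have h3 : m.z lam x = m.g x - lam * x := rfl
      refine ⟨?_, ?_⟩
      · have := mul_nonneg hs0 hx.1.le
        show m.g x - x * m.slope x ≤ m.z lam x
        linarith
      · have h := m.z_le_tangent lam hxs ⟨hx.1.le, hx.2⟩
        have h4 : m.z lam xs = m.g xs - lam * xs := rfl
        show m.z lam x ≤ m.g xs - xs * m.slope xs
        rw [hs] at h ⊢
        linarith)
  refine ⟨xs, ηL, ηH, (isXStar_iff m hlam).2 ⟨hxs, hs⟩, ⟨⟨hu.1.trans_le hL.1, hLx⟩, ?_⟩,
    ⟨by rw [min_comm]; exact hH, ?_⟩⟩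
  · show m.g ηL + (1 - ηL) * m.slope ηL - m.z lam x / β = lam
    linarith
  · show m.g ηH - ηH * m.slope ηH - m.z lam x = 0
    exact sub_eq_zero.2 hHe

lemma IsClipData.unique (hβ0 : 0 < β) (hlam : 0 ≤ lam) {xs' ηL' ηH' : ℝ}
    (h : IsClipData m β lam xs ηL ηH) (h' : IsClipData m β lam xs' ηL' ηH') :
    xs' = xs ∧ ηL' = ηL ∧ ηH' = ηH := by
  obtain ⟨h1, ⟨h2, h3⟩, h4, h5⟩ := h
  obtain ⟨h1', ⟨h2', h3'⟩, h4', h5'⟩ := h'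
  rw [isXStar_iff m hlam] at h1 h1'
  obtain rfl : xs' = xs := m.slope_injOn h1'.1 h1.1 (h1'.2.trans h1.2.symm)
  have hx := min_mem_Ioc hβ0 h1.1
  refine ⟨rfl, ?_, ?_⟩
  · refine (tangent_at_one_strictAntiOn m).injOn ⟨h2'.1, h2'.2.le.trans hx.2⟩
      ⟨h2.1, h2.2.le.trans hx.2⟩ ?_
    show m.g ηL' + (1 - ηL') * m.Vbar (m.yth ηL') = m.g ηL + (1 - ηL) * m.Vbar (m.yth ηL)
    linarith
  · rw [min_comm] at h4 h4'
    refine (tangent_at_zero_strictMonoOn m).injOn ⟨hx.1.trans_le h4'.1, h4'.2.trans h1.1.2⟩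
      ⟨hx.1.trans_le h4.1, h4.2.trans h1.1.2⟩ ?_
    show m.g ηH' - ηH' * m.Vbar (m.yth ηH') = m.g ηH - ηH * m.Vbar (m.yth ηH)
    linarith

/-- What the analysis of the algorithm uses about the clipping bounds. -/
structure ClipBounds (m : SensorModel Ω μ) (β lam xs ηL ηH : ℝ) : Prop where
  beta_pos : 0 < β
  beta_lt_one : β < 1
  lam_nonneg : 0 ≤ lam
  xs_mem : xs ∈ Ioc (0:ℝ) 1
  slope_xs : m.slope xs = lam
  low_pos : 0 < ηL
  low_lt_high : ηL < ηH
  high_le : ηH ≤ xs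
  high_lt_one : ηH < 1
  low_eq : m.z lam ηL + (1 - ηL) * (m.slope ηL - lam) = m.z lam (min xs β) / β
  high_eq : m.z lam ηH - ηH * (m.slope ηH - lam) = m.z lam (min xs β)

lemma IsClipData.clipBounds (hβ0 : 0 < β) (hβ1 : β < 1) (hlam : 0 ≤ lam)
    (h : IsClipData m β lam xs ηL ηH) : ClipBounds m β lam xs ηL ηH := by
  obtain ⟨h1, ⟨h2, h3⟩, h4, h5⟩ := h
  rw [isXStar_iff m hlam] at h1
  rw [min_comm] at h4
  have hH : m.z lam ηH - ηH * (m.slope ηH - lam) = m.z lam (min xs β) := by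
    have h6 : m.z lam ηH = m.g ηH - lam * ηH := rfl
    have h7 : m.slope ηH = m.Vbar (m.yth ηH) := rfl
    rw [h6, h7]
    linarith
  have hL : m.z lam ηL + (1 - ηL) * (m.slope ηL - lam) = m.z lam (min xs β) / β := by
    have h6 : m.z lam ηL = m.g ηL - lam * ηL := rfl
    have h7 : m.slope ηL = m.Vbar (m.yth ηL) := rfl
    rw [h6, h7]
    linarith
  refine ⟨hβ0, hβ1, hlam, h1.1, h1.2, h2.1, h2.2.trans_le h4.1, h4.2, ?_, hL, hH⟩
  -- If ηH = 1, then x* = 1 and the equation for ηH reads z(1) = z(β), against strict maximality at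
  -- x*.
  refine lt_of_le_of_ne (h4.2.trans h1.1.2) fun h6 => ?_
  subst h6
  obtain rfl : xs = 1 := le_antisymm h1.1.2 h4.2
  rw [h1.2, min_eq_right hβ1.le] at hH
  have h7 := m.z_lt_tangent lam h1.1 ⟨hβ0.le, hβ1.le⟩ hβ1.ne
  rw [h1.2] at h7
  linarith

end ClipData

/-! ### Concavity of relative values and stability of monotone policies -/

section Regular

variable {Ω : Type*} [MeasurableSpace Ω] {μ : Measure Ω} [IsProbabilityMeasure μ] {N : ℕ}
  {m : SensorModel Ω μ} {β lam xs ηL ηH : ℝ} {η η' v : Policy N}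

/-- Monotone policies with values between the clipping bounds. -/
structure Regular (ηL ηH : ℝ) (η : Policy N) : Prop where
  zero : η 0 = 0
  mem : ∀ e, e ≠ 0 → η e ∈ Icc ηL ηH
  mono : Monotone η

lemma ClipBounds.mem_Ioc (hc : ClipBounds m β lam xs ηL ηH) {a : ℝ} (ha : a ∈ Icc ηL ηH) :
    a ∈ Ioc (0:ℝ) 1 :=
  ⟨hc.low_pos.trans_le ha.1, ha.2.trans hc.high_lt_one.le⟩

lemma ClipBounds.high_mem (hc : ClipBounds m β lam xs ηL ηH) : ηH ∈ Icc ηL ηH :=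
  right_mem_Icc.2 hc.low_lt_high.le

lemma ClipBounds.low_mem (hc : ClipBounds m β lam xs ηL ηH) : ηL ∈ Icc ηL ηH :=
  left_mem_Icc.2 hc.low_lt_high.le

lemma last_ne_zero_of_one_le (hN : 1 ≤ N) : Fin.last N ≠ 0 := by
  intro h
  have := congrArg Fin.val h
  simp at this
  omega

lemma Regular.admissible (hc : ClipBounds m β lam xs ηL ηH) (hN : 1 ≤ N)
    (h : Regular ηL ηH η) : Admissible η := by
  have hpos : ∀ e, e ≠ 0 → 0 < η e ∧ η e < 1 := fun e he =>
    ⟨hc.low_pos.trans_le (h.mem e he).1, (h.mem e he).2.trans_lt hc.high_lt_one⟩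
  have hl := hpos _ (last_ne_zero_of_one_le hN)
  exact ⟨h.zero, ⟨hl.1, hl.2.le⟩, fun e he _ => hpos e he⟩

lemma Regular.nonneg (h : Regular ηL ηH η) (e : Fin (N + 1)) :
    0 ≤ η e := by
  rw [← h.zero]
  exact h.mono (Fin.zero_le e)

lemma Regular.le_high (hc : ClipBounds m β lam xs ηL ηH) (h : Regular ηL ηH η) (e : Fin (N + 1)) :
    η e ≤ ηH := by
  by_cases he : e = 0
  · rw [he, h.zero]; exact hc.low_pos.le.trans hc.low_lt_high.le
  · exact (h.mem e he).2

lemma ClipBounds.slope_sub_nonneg (hc : ClipBounds m β lam xs ηL ηH) {a : ℝ} (ha0 : 0 < a)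
    (ha : a ≤ xs) : 0 ≤ m.slope a - lam := by
  rw [← hc.slope_xs, sub_nonneg]
  exact m.slope_strictAntiOn.antitoneOn ⟨ha0, ha.trans hc.xs_mem.2⟩ hc.xs_mem ha

/-- The reward per slot is at most that of the best power-feasible constant policy. -/
lemma Z_le (hc : ClipBounds m β lam xs ηL ηH) (h : Admissible η) :
    Z m β lam η ≤ m.z lam (min xs β) := by
  have hx := min_mem_Ioc hc.beta_pos hc.xs_mem
  have hs0 := slope_min_sub_nonneg m hc.beta_pos hc.xs_mem hc.slope_xs
  have hsm := slope_min_sub_mul m (β := β) hc.slope_xs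
  set x := min xs β
  -- Jensen's inequality via the tangent at x: the linear term averages to at most zero, by
  -- `avgPower_le` and slackness.
  have h1 : Z m β lam η ≤ ∑ e, steadyState β η e *
      (m.z lam x + (m.slope x - lam) * (η e - x)) := by
    rw [Z_eq_sum m h]
    exact Finset.sum_le_sum fun e _ => mul_le_mul_of_nonneg_left
      (m.z_le_tangent lam hx (h.mem_Icc e)) (steadyState_pos hc.beta_pos hc.beta_lt_one h e).le
  have h2 : ∀ e, steadyState β η e * (m.z lam x + (m.slope x - lam) * (η e - x)) =
      steadyState β η e * (m.z lam x - (m.slope x - lam) * x) +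
        (m.slope x - lam) * (steadyState β η e * η e) := fun e => by ring
  simp only [h2] at h1
  rw [Finset.sum_add_distrib, ← Finset.sum_mul, ← Finset.mul_sum, ← avgPower_eq h,
    sum_steadyState hc.beta_pos hc.beta_lt_one h] at h1
  have h3 := mul_le_mul_of_nonneg_left (avgPower_le hc.beta_pos hc.beta_lt_one h) hs0
  linarith

lemma Regular.Z_le_z_last (hc : ClipBounds m β lam xs ηL ηH) (hN : 1 ≤ N)
    (h : Regular ηL ηH η) : Z m β lam η ≤ m.z lam (η (Fin.last N)) := by
  have ha := h.admissible hc hN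
  have hl := hc.mem_Ioc (h.mem _ (last_ne_zero_of_one_le hN))
  have hs := hc.slope_sub_nonneg hl.1 ((h.le_high hc _).trans hc.high_le)
  rw [Z_eq_sum m ha]
  calc ∑ e, steadyState β η e * m.z lam (η e)
      ≤ ∑ e, steadyState β η e * m.z lam (η (Fin.last N)) := by
        refine Finset.sum_le_sum fun e _ => mul_le_mul_of_nonneg_left ?_
          (steadyState_pos hc.beta_pos hc.beta_lt_one ha e).le
        have h1 := m.z_le_tangent lam hl (ha.mem_Icc e)
        have h2 := mul_nonneg hs (sub_nonneg.2 (h.mono (Fin.le_last e)))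
        linarith
    _ = m.z lam (η (Fin.last N)) := by
        rw [← Finset.sum_mul, sum_steadyState hc.beta_pos hc.beta_lt_one ha, one_mul]

/-- Below `β`, the slope of the chord to `(β, c)` decreases. -/
lemma ClipBounds.chord_below (hc : ClipBounds m β lam xs ηL ηH) {c a a' : ℝ}
    (hz : c ≤ m.z lam (min xs β)) (ha0 : 0 ≤ a) (haa : a ≤ a') (ha' : a' < β) (hxs : a' ≤ xs) :
    (β - a) * (c - m.z lam a') ≤ (β - a') * (c - m.z lam a) := by
  rcases haa.eq_or_lt with rfl | hlt
  · exact le_rfl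
  have hmem : a' ∈ Ioc (0:ℝ) 1 := ⟨ha0.trans_lt hlt, hxs.trans hc.xs_mem.2⟩
  have hs := hc.slope_sub_nonneg hmem.1 hxs
  have hx := min_mem_Ioc hc.beta_pos hc.xs_mem
  have h1 := m.z_le_tangent lam hmem ⟨ha0, haa.trans hmem.2⟩
  have h2 := m.z_le_tangent lam hmem ⟨hx.1.le, hx.2⟩
  have h3 := mul_le_mul_of_nonneg_left (min_le_right xs β) hs
  set s := m.slope a' - lam
  have h4 : c - m.z lam a' ≤ s * (β - a') := by linarith
  have h5 := mul_le_mul_of_nonneg_left h4 (sub_nonneg.2 haa)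
  have h6 := mul_le_mul_of_nonneg_left h1 (sub_nonneg.2 ha'.le)
  linarith

/-- Above `β`, the slope of the chord from `(β, c)` decreases. -/
lemma ClipBounds.chord_above (hc : ClipBounds m β lam xs ηL ηH) {c a a' : ℝ}
    (hz : c ≤ m.z lam (min xs β)) (ha : β < a) (haa : a ≤ a') (hxs : a' ≤ xs) :
    (a - β) * (m.z lam a' - c) ≤ (a' - β) * (m.z lam a - c) := by
  have hmem : a ∈ Ioc (0:ℝ) 1 := ⟨hc.beta_pos.trans ha, (haa.trans hxs).trans hc.xs_mem.2⟩
  rw [min_eq_right (ha.le.trans (haa.trans hxs))] at hz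
  have h1 := m.z_le_tangent lam hmem ⟨hmem.1.le.trans haa, hxs.trans hc.xs_mem.2⟩
  have h2 := m.z_le_tangent lam hmem ⟨hc.beta_pos.le, hc.beta_lt_one.le⟩
  set s := m.slope a - lam
  have h4 : s * (a - β) ≤ m.z lam a - c := by linarith
  have h5 := mul_le_mul_of_nonneg_left h4 (sub_nonneg.2 haa)
  have h6 := mul_le_mul_of_nonneg_left h1 (sub_nonneg.2 ha.le)
  linarith

/-- Equal increments d solve the balance equation at a = η(e) exactly when (β - a)d = Z - z(a). For
a < β the chord slope (Z - z(a)) / (β - a) is thus the fixed point of an increasing recursion, so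
increments above it stay above it; by `ClipBounds.chord_below` it decreases as a grows. -/
lemma Regular.forward (hc : ClipBounds m β lam xs ηL ηH) (hN : 1 ≤ N) (h : Regular ηL ηH η)
    (hv : IsRelativeValue m β lam η v) (e : Fin (N + 1)) (he : η e < β) :
    Z m β lam η - m.z lam (η e) ≤ (β - η e) * upDiff v e ∧
      (e ≠ 0 → Z m β lam η - m.z lam (η e) ≤ (β - η e) * downDiff v e) := by
  have hrel := ((isRelativeValue_iff m (h.admissible hc hN)).1 hv).2
  induction e using Fin.induction with
  | zero =>
    have h1 := hrel 0
    rw [h.zero] at h1 ⊢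
    refine ⟨by linarith, fun h => absurd rfl h⟩
  | succ k ih =>
    have hle : η k.castSucc ≤ η k.succ := h.mono (Fin.castSucc_lt_succ).le
    have hlt : η k.castSucc < β := hle.trans_lt he
    have h1 := (ih hlt).1
    rw [upDiff_castSucc, ← downDiff_succ] at h1
    have h2 := hc.chord_below (Z_le hc (h.admissible hc hN)) (h.nonneg _) hle he
      ((h.le_high hc _).trans hc.high_le)
    have hpos : 0 < β - η k.castSucc := sub_pos.2 hlt
    have h3 : Z m β lam η - m.z lam (η k.succ) ≤ (β - η k.succ) * downDiff v k.succ := by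
      refine le_of_mul_le_mul_left ?_ hpos
      have h4 := mul_le_mul_of_nonneg_left h1 (sub_pos.2 he).le
      linarith
    refine ⟨?_, fun _ => h3⟩
    have hr := hrel k.succ
    have ha1 : η k.succ < 1 := (h.le_high hc _).trans_lt hc.high_lt_one
    refine le_of_mul_le_mul_left ?_ (mul_pos hc.beta_pos (sub_pos.2 ha1))
    have h5 := mul_le_mul_of_nonneg_left h3
      (mul_nonneg (sub_pos.2 hc.beta_lt_one).le (h.nonneg k.succ))
    linear_combination h5 + (η k.succ - β) * hr

/-- The mirror image above β, run down from the full battery, where the upward increment is zero and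
the claim is Z ≤ z(η(N)). -/
lemma Regular.backward (hc : ClipBounds m β lam xs ηL ηH) (hN : 1 ≤ N) (h : Regular ηL ηH η)
    (hv : IsRelativeValue m β lam η v) (e : Fin (N + 1)) (he : β < η e) :
    (η e - β) * downDiff v e ≤ m.z lam (η e) - Z m β lam η := by
  have hrel := ((isRelativeValue_iff m (h.admissible hc hN)).1 hv).2
  have hb := sub_pos.2 hc.beta_lt_one
  have key : ∀ e, β < η e →
      (η e - β) * upDiff v e ≤ m.z lam (η e) - Z m β lam η →
      (η e - β) * downDiff v e ≤ m.z lam (η e) - Z m β lam η := by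
    intro e he hup
    have ha1 : η e < 1 := (h.le_high hc _).trans_lt hc.high_lt_one
    refine le_of_mul_le_mul_left ?_ (mul_pos hb (hc.beta_pos.trans he))
    have h5 := mul_le_mul_of_nonneg_left hup (mul_pos hc.beta_pos (sub_pos.2 ha1)).le
    linear_combination h5 + (β - η e) * hrel e
  induction e using Fin.reverseInduction with
  | last =>
    refine key _ he ?_
    rw [upDiff_last, mul_zero, sub_nonneg]
    exact h.Z_le_z_last hc hN
  | cast k ih =>
    have hle : η k.castSucc ≤ η k.succ := h.mono (Fin.castSucc_lt_succ).le
    have hlt : β < η k.succ := he.trans_le hle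
    refine key _ he ?_
    have h1 := ih hlt
    have h2 := hc.chord_above (Z_le hc (h.admissible hc hN)) he hle
      ((h.le_high hc _).trans hc.high_le)
    rw [upDiff_castSucc, ← downDiff_succ]
    refine le_of_mul_le_mul_left ?_ (sub_pos.2 hlt)
    have h4 := mul_le_mul_of_nonneg_left h1 (sub_pos.2 he).le
    linarith

/-- The relative value function of a regular policy is concave. -/
lemma Regular.upDiff_le_downDiff (hc : ClipBounds m β lam xs ηL ηH) (hN : 1 ≤ N)
    (h : Regular ηL ηH η) (hv : IsRelativeValue m β lam η v) {e : Fin (N + 1)} (he : e ≠ 0) :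
    upDiff v e ≤ downDiff v e := by
  have hrel := ((isRelativeValue_iff m (h.admissible hc hN)).1 hv).2 e
  have ha1 : η e < 1 := (h.le_high hc _).trans_lt hc.high_lt_one
  -- By the balance equation the left side equals β(1 - η(e)) times `upDiff` minus `downDiff`.
  have hF : Z m β lam η - m.z lam (η e) + (η e - β) * downDiff v e ≤ 0 := by
    rcases lt_trichotomy (η e) β with h1 | h1 | h1
    · have := (h.forward hc hN hv e h1).2 he
      linarith
    · have h2 := Z_le hc (h.admissible hc hN)
      rw [min_eq_right (h1 ▸ (h.le_high hc e).trans hc.high_le)] at h2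
      rw [h1]
      linarith
    · have := h.backward hc hN hv e h1
      linarith
  refine le_of_mul_le_mul_left ?_ (mul_pos hc.beta_pos (sub_pos.2 ha1))
  linarith

/-- Up to λ, x(e) is a weighted mean of two consecutive increments of v, and these decrease by
concavity. -/
lemma Regular.rootLevel_antitone (hc : ClipBounds m β lam xs ηL ηH) (hN : 1 ≤ N)
    (h : Regular ηL ηH η) {e f : Fin (N + 1)} (he : e ≠ 0) (hef : e ≤ f) :
    rootLevel m β lam η f ≤ rootLevel m β lam η e := by
  have hA := h.admissible hc hN
  have hv := isRelativeValue_relValue m (lam := lam) hc.beta_pos hc.beta_lt_one hA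
  set v := relValue m β lam η
  have hup := fun {e} he => h.upDiff_le_downDiff hc hN hv (e := e) he
  simp only [hv.rootLevel_eq m hc.beta_pos hA]
  induction f using Fin.induction with
  | zero => exact absurd (Fin.le_zero_iff.1 hef) he
  | succ k ih =>
    rcases hef.eq_or_lt with rfl | hlt
    · exact le_rfl
    · have hek : e ≤ k.castSucc := Fin.le_castSucc_iff.2 hlt
      refine le_trans ?_ (ih hek)
      have hk : k.castSucc ≠ 0 := fun h0 => he (Fin.le_zero_iff.1 (h0 ▸ hek))
      have h1 := mul_le_mul_of_nonneg_left (hup (Fin.succ_ne_zero k)) hc.beta_pos.le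
      have h2 := mul_le_mul_of_nonneg_left (hup hk) (sub_pos.2 hc.beta_lt_one).le
      have h3 : downDiff v k.succ = upDiff v k.castSucc := by
        rw [downDiff_succ, upDiff_castSucc]
      rw [h3] at h1 ⊢
      linarith

/-- The full battery is the worst case; there the balance equation makes the last increment a
positive multiple of z(η(N)) - Z ≥ 0. -/
lemma Regular.rootLevel_nonneg (hc : ClipBounds m β lam xs ηL ηH) (hN : 1 ≤ N)
    (h : Regular ηL ηH η) {e : Fin (N + 1)} (he : e ≠ 0) : 0 ≤ rootLevel m β lam η e := by
  refine le_trans ?_ (h.rootLevel_antitone hc hN he (Fin.le_last e))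
  have hA := h.admissible hc hN
  have hv := isRelativeValue_relValue m (lam := lam) hc.beta_pos hc.beta_lt_one hA
  rw [hv.rootLevel_eq m hc.beta_pos hA, upDiff_last]
  have h1 := ((isRelativeValue_iff m hA).1 hv).2 (Fin.last N)
  rw [upDiff_last] at h1
  have h2 := h.Z_le_z_last hc hN
  have hpos := mul_pos (sub_pos.2 hc.beta_lt_one) (hA.pos (last_ne_zero_of_one_le hN))
  have h3 : 0 ≤ downDiff (relValue m β lam η) (Fin.last N) := by
    refine le_of_mul_le_mul_left ?_ hpos
    linarith
  have h4 := mul_nonneg (sub_pos.2 hc.beta_lt_one).le h3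
  linarith [hc.lam_nonneg]

lemma clip_mem (hLH : ηL ≤ ηH) (u : ℝ) : clip ηL ηH u ∈ Icc ηL ηH := by
  unfold clip
  split_ifs with h1 h2
  · exact ⟨hLH, le_rfl⟩
  · exact ⟨le_rfl, hLH⟩
  · exact ⟨not_lt.1 h2, not_lt.1 h1⟩

lemma clip_mono (hLH : ηL ≤ ηH) : Monotone (clip ηL ηH) := by
  intro u w huw
  unfold clip
  split_ifs <;> linarith

lemma existsUnique_isRoot {e : Fin (N + 1)} (h : 0 ≤ rootLevel m β lam η e) :
    ∃! u, IsRoot m β lam η e u := by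
  obtain ⟨u, hu, hs⟩ := m.exists_slope_eq h
  exact ⟨u, ⟨hu, hs⟩, fun w hw => m.slope_injOn hw.1 hu (hw.2.trans hs.symm)⟩

lemma Improves.unique {η'' : Policy N} (h : Improves m β lam ηL ηH η η')
    (h' : Improves m β lam ηL ηH η η'') : η' = η'' := by
  funext e
  by_cases he : e = 0
  · rw [he, h.1, h'.1]
  · obtain ⟨u, hu, h1⟩ := h.2 e he
    obtain ⟨w, hw, h2⟩ := h'.2 e he
    rw [h1, h2, m.slope_injOn hu.1 hw.1 (hu.2.trans hw.2.symm)]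

lemma Regular.exists_improves (hc : ClipBounds m β lam xs ηL ηH) (hN : 1 ≤ N)
    (h : Regular ηL ηH η) : ∃ η', Improves m β lam ηL ηH η η' := by
  have h1 : ∀ e, ∃ u, e ≠ 0 → IsRoot m β lam η e u := fun e => by
    by_cases he : e = 0
    · exact ⟨0, fun h => absurd he h⟩
    · obtain ⟨u, hu, -⟩ := existsUnique_isRoot (h.rootLevel_nonneg hc hN he)
      exact ⟨u, fun _ => hu⟩
  choose u hu using h1
  exact ⟨fun e => if e = 0 then 0 else clip ηL ηH (u e), by simp,
    fun e he => ⟨u e, hu e he, by simp [he]⟩⟩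

/-- Lower values x(e) give larger roots, and clipping preserves order. Clipping can create ties,
hence the weak monotonicity in `Regular`. -/
lemma Regular.improves (hc : ClipBounds m β lam xs ηL ηH) (hN : 1 ≤ N)
    (h : Regular ηL ηH η) (hi : Improves m β lam ηL ηH η η') : Regular ηL ηH η' := by
  refine ⟨hi.1, fun e he => ?_, fun e f hef => ?_⟩
  · obtain ⟨u, -, h1⟩ := hi.2 e he
    rw [h1]
    exact clip_mem hc.low_lt_high.le u
  · by_cases hf : f = 0
    · subst hf
      rw [Fin.le_zero_iff.1 hef]
    obtain ⟨w, hw, h2⟩ := hi.2 f hf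
    by_cases he : e = 0
    · rw [he, hi.1, h2]
      exact hc.low_pos.le.trans (clip_mem hc.low_lt_high.le w).1
    obtain ⟨u, hu, h1⟩ := hi.2 e he
    rw [h1, h2]
    refine clip_mono hc.low_lt_high.le ?_
    rw [← m.slope_strictAntiOn.le_iff_ge hw.1 hu.1]
    have h3 := h.rootLevel_antitone hc hN he hef
    rw [← hu.2, ← hw.2] at h3
    exact h3

/-- Clipping the unconstrained maximizer gives the constrained one. -/
lemma ClipBounds.lt_clip (hc : ClipBounds m β lam xs ηL ηH) {u a : ℝ} (hu : u ∈ Ioc (0:ℝ) 1)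
    (ha : a ∈ Icc ηL ηH) (hne : a ≠ clip ηL ηH u) :
    m.g a - m.slope u * a < m.g (clip ηL ηH u) - m.slope u * clip ηL ηH u := by
  have ha1 := hc.mem_Ioc ha
  have hk := hc.mem_Ioc (clip_mem hc.low_lt_high.le u)
  have h1 := m.g_lt_tangent hk ⟨ha1.1.le, ha1.2⟩ hne
  -- The two slopes differ only if the clip acts, and then all of [ηL, ηH] lies on the favourable
  -- side of the clipped value.
  have h2 : m.slope (clip ηL ηH u) * (a - clip ηL ηH u) ≤ m.slope u * (a - clip ηL ηH u) := by
    unfold clip at *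
    split_ifs at * with h3 h4
    · exact mul_le_mul_of_nonpos_right (m.slope_strictAntiOn hk hu h3).le (sub_nonpos.2 ha.2)
    · exact mul_le_mul_of_nonneg_right (m.slope_strictAntiOn hu hk h4).le (sub_nonneg.2 ha.1)
    · exact le_rfl
  linarith

lemma Improves.lt (hc : ClipBounds m β lam xs ηL ηH) (hi : Improves m β lam ηL ηH η η')
    {e : Fin (N + 1)} (he : e ≠ 0) {a : ℝ} (ha : a ∈ Icc ηL ηH) (hne : a ≠ η' e) :
    m.g a - rootLevel m β lam η e * a < m.g (η' e) - rootLevel m β lam η e * η' e := by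
  obtain ⟨u, hu, h1⟩ := hi.2 e he
  rw [h1] at hne ⊢
  rw [← hu.2]
  exact hc.lt_clip hu.1 ha hne

lemma Improves.mem (hc : ClipBounds m β lam xs ηL ηH) (hi : Improves m β lam ηL ηH η η')
    {e : Fin (N + 1)} (he : e ≠ 0) : η' e ∈ Icc ηL ηH := by
  obtain ⟨u, -, h1⟩ := hi.2 e he
  rw [h1]
  exact clip_mem hc.low_lt_high.le u

theorem Improves.lookAhead_lt (hc : ClipBounds m β lam xs ηL ηH) (h : Admissible η)
    (hi : Improves m β lam ηL ηH η η') (hv : IsRelativeValue m β lam η v)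
    {e : Fin (N + 1)} (he : e ≠ 0) {a : ℝ} (ha : a ∈ Icc ηL ηH) (hne : a ≠ η' e) :
    m.z lam a + ∑ f, battKernel β a e f * v f <
      m.z lam (η' e) + ∑ f, battKernel β (η' e) e f * v f := by
  rw [hv.lookAhead_eq m hc.beta_pos h (Or.inl he), hv.lookAhead_eq m hc.beta_pos h (Or.inl he)]
  have := hi.lt hc he ha hne
  linarith

end Regular

/-! ### Optimality of the fixed point and convergence -/

section Convergence

/-- Off a neighbourhood of x₀ the rest of K is compact, so the maximum of f there is strictly below
f x₀. -/
lemma tendsto_of_isCompact_of_unique_max {X ι : Type*} [TopologicalSpace X] {K : Set X}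
    (hK : IsCompact K) {f : X → ℝ} (hf : ContinuousOn f K) {x₀ : X}
    (hmax : ∀ x ∈ K, x ≠ x₀ → f x < f x₀) {l : Filter ι} {u : ι → X} (hu : ∀ᶠ i in l, u i ∈ K)
    (hfu : Tendsto (fun i => f (u i)) l (𝓝 (f x₀))) : Tendsto u l (𝓝 x₀) := by
  rw [tendsto_nhds]
  intro U hU hx
  rcases (K \ U).eq_empty_or_nonempty with h | h
  · filter_upwards [hu] with i hi
    by_contra hiU
    exact (h ▸ (⟨hi, hiU⟩ : u i ∈ K \ U) : u i ∈ (∅ : Set X))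
  · obtain ⟨x₁, hx₁, h1⟩ := (hK.diff hU).exists_isMaxOn h (hf.mono sdiff_subset)
    have hlt : f x₁ < f x₀ := hmax x₁ hx₁.1 fun h2 => hx₁.2 (h2 ▸ hx)
    filter_upwards [hu, hfu.eventually (lt_mem_nhds hlt)] with i hi hlt'
    by_contra hiU
    exact absurd (h1 (⟨hi, hiU⟩ : u i ∈ K \ U)) (not_le.2 hlt')

variable {Ω : Type*} [MeasurableSpace Ω] {μ : Measure Ω} [IsProbabilityMeasure μ] {N : ℕ}
  {m : SensorModel Ω μ} {β lam xs ηL ηH : ℝ} {η η' v : Policy N}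

lemma isCompact_regular : IsCompact {η : Policy N | Regular ηL ηH η} := by
  have h : {η : Policy N | Regular ηL ηH η} =
      Set.pi univ (fun e => if e = 0 then ({0} : Set ℝ) else Icc ηL ηH) ∩ {η | Monotone η} := by
    ext η
    constructor
    · intro h
      refine ⟨fun e _ => ?_, h.mono⟩
      dsimp only
      split_ifs with he
      · rw [he]; exact h.zero
      · exact h.mem e he
    · rintro ⟨h1, h2⟩
      refine ⟨by simpa using h1 0 trivial, fun e he => by simpa [he] using h1 e trivial, h2⟩
  rw [h]
  refine (isCompact_univ_pi fun e => ?_).inter_right isClosed_monotone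
  split_ifs
  · exact isCompact_singleton
  · exact isCompact_Icc

lemma ClipBounds.regular_nonempty (hc : ClipBounds m β lam xs ηL ηH) :
    {η : Policy N | Regular ηL ηH η}.Nonempty := by
  refine ⟨fun e => if e = 0 then 0 else ηL, by simp, fun e he => by simpa [he] using
    hc.low_lt_high.le, fun e f hef => ?_⟩
  split_ifs with h1 h2
  · exact le_rfl
  · exact hc.low_pos.le
  · exact absurd (Fin.le_zero_iff.1 (by assumption ▸ hef)) h1
  · exact le_rfl

lemma ClipBounds.continuousOn_steadyState (hc : ClipBounds m β lam xs ηL ηH) (hN : 1 ≤ N)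
    (e : Fin (N + 1)) :
    ContinuousOn (fun η : Policy N => steadyState β η e) {η | Regular ηL ηH η} := by
  have hb := sub_pos.2 hc.beta_lt_one
  have hcoord : ∀ f, ContinuousOn (fun η : Policy N => η f) {η | Regular ηL ηH η} := fun f =>
    (continuous_apply f).continuousOn
  have hne : ∀ f, f ≠ 0 → ∀ η ∈ {η : Policy N | Regular ηL ηH η}, (1 - β) * η f ≠ 0 :=
    fun f hf η hη => (mul_pos hb ((Regular.admissible hc hN hη).pos hf)).ne'
  have hw : ∀ e, ContinuousOn (fun η : Policy N => steadyWeight β η e)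
      {η | Regular ηL ηH η} := by
    intro e
    unfold steadyWeight
    by_cases he : e = 0
    · simp only [he, if_true]
      exact continuousOn_const
    · simp only [he, if_false]
      refine ContinuousOn.mul (continuousOn_finsetProd _ fun f hf => ?_)
        (continuousOn_const.div (continuousOn_const.mul (hcoord e)) (hne e he))
      exact (continuousOn_const.mul (continuousOn_const.sub (hcoord f))).div
        (continuousOn_const.mul (hcoord f)) (hne f (Finset.mem_Ioo.1 hf).1.ne')
  exact (hw e).div (continuousOn_finsetSum _ fun f _ => hw f) fun η hη =>
    (sum_steadyWeight_pos hc.beta_pos hc.beta_lt_one (Regular.admissible hc hN hη)).ne'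

lemma ClipBounds.continuousOn_Z (hc : ClipBounds m β lam xs ηL ηH) (hN : 1 ≤ N) :
    ContinuousOn (fun η : Policy N => Z m β lam η) {η | Regular ηL ηH η} := by
  have hcoord : ∀ f, ContinuousOn (fun η : Policy N => η f) {η | Regular ηL ηH η} := fun f =>
    (continuous_apply f).continuousOn
  refine ContinuousOn.sub (continuousOn_finsetSum _ fun e _ => ?_)
    (continuousOn_const.mul (continuousOn_finsetSum _ fun e _ => ?_))
  · exact (hc.continuousOn_steadyState hN _).mul (m.g_continuousOn.comp (hcoord _)
      fun η hη => hc.mem_Ioc (Regular.mem hη _ (Fin.succ_ne_zero e)))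
  · exact (hc.continuousOn_steadyState hN _).mul (hcoord _)

lemma ClipBounds.exists_le_steadyState (hc : ClipBounds m β lam xs ηL ηH) (hN : 1 ≤ N) :
    ∃ c > 0, ∀ η : Policy N, Regular ηL ηH η → ∀ e, c ≤ steadyState β η e := by
  have h : ∀ e : Fin (N + 1), ∃ c > 0, ∀ η : Policy N, Regular ηL ηH η →
      c ≤ steadyState β η e := by
    intro e
    obtain ⟨η, hη, h1⟩ := isCompact_regular.exists_isMinOn (hc.regular_nonempty (N := N))
      (hc.continuousOn_steadyState hN e)
    exact ⟨_, steadyState_pos hc.beta_pos hc.beta_lt_one (Regular.admissible hc hN hη) e,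
      fun η' h' => h1 h'⟩
  choose c hc0 hc1 using h
  obtain ⟨e, he⟩ := Finite.exists_min c
  exact ⟨c e, hc0 e, fun η hη f => (he f).trans (hc1 f η hη)⟩

lemma Improves.le (hc : ClipBounds m β lam xs ηL ηH) (hi : Improves m β lam ηL ηH η η')
    {η'' : Policy N} (h'' : Regular ηL ηH η'') (e : Fin (N + 1)) :
    m.g (η'' e) - rootLevel m β lam η e * η'' e ≤ m.g (η' e) - rootLevel m β lam η e * η' e := by
  by_cases he : e = 0
  · rw [he, hi.1, h''.zero]
  by_cases hne : η'' e = η' e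
  · rw [hne]
  · exact (hi.lt hc he (h''.mem e he) hne).le

lemma Improves.Z_le (hc : ClipBounds m β lam xs ηL ηH) (hN : 1 ≤ N) (h : Regular ηL ηH η)
    (hi : Improves m β lam ηL ηH η η') : Z m β lam η ≤ Z m β lam η' := by
  have hA' := (h.improves hc hN hi).admissible hc hN
  rw [← sub_nonneg, Z_sub_Z_eq m hc.beta_pos hc.beta_lt_one (h.admissible hc hN) hA']
  exact Finset.sum_nonneg fun e _ => mul_nonneg
    (steadyState_pos hc.beta_pos hc.beta_lt_one hA' e).le (sub_nonneg.2 (hi.le hc h e))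

/-- Every level has positive stationary probability, so a strict gain at one level already raises Z.
-/
lemma Improves.eq_of_Z_le (hc : ClipBounds m β lam xs ηL ηH) (hN : 1 ≤ N) (h : Regular ηL ηH η)
    (hi : Improves m β lam ηL ηH η η') (hZ : Z m β lam η' ≤ Z m β lam η) : η = η' := by
  have hA' := (h.improves hc hN hi).admissible hc hN
  rw [← sub_nonpos, Z_sub_Z_eq m hc.beta_pos hc.beta_lt_one (h.admissible hc hN) hA'] at hZ
  by_contra hne
  obtain ⟨e, he⟩ := Function.ne_iff.1 hne
  have he0 : e ≠ 0 := by
    rintro rfl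
    exact he (h.zero.trans hi.1.symm)
  refine absurd hZ (not_le.2 (Finset.sum_pos' (fun f _ => mul_nonneg
    (steadyState_pos hc.beta_pos hc.beta_lt_one hA' f).le (sub_nonneg.2 (hi.le hc h f)))
    ⟨e, Finset.mem_univ e, mul_pos (steadyState_pos hc.beta_pos hc.beta_lt_one hA' e)
      (sub_pos.2 (hi.lt hc he0 (h.mem e he0) he))⟩))

/-- One policy improvement closes a fixed fraction of the gap to any regular policy. -/
lemma Improves.gap_le (hc : ClipBounds m β lam xs ηL ηH) (hN : 1 ≤ N) (h : Regular ηL ηH η)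
    (hi : Improves m β lam ηL ηH η η') {c : ℝ} (hc0 : 0 < c)
    (hcle : ∀ e, c ≤ steadyState β η' e) {η'' : Policy N} (h'' : Regular ηL ηH η'') :
    c * (Z m β lam η'' - Z m β lam η) ≤ Z m β lam η' - Z m β lam η := by
  have hA := h.admissible hc hN
  have hA' := (h.improves hc hN hi).admissible hc hN
  have hA'' := h''.admissible hc hN
  rw [Z_sub_Z_eq m hc.beta_pos hc.beta_lt_one hA hA',
    Z_sub_Z_eq m hc.beta_pos hc.beta_lt_one hA hA'', Finset.mul_sum]
  refine Finset.sum_le_sum fun e _ => ?_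
  have h1 := hi.le hc h'' e
  have h2 := hi.le hc h e
  have hp := steadyState_pos hc.beta_pos hc.beta_lt_one hA'' e
  have hp1 := steadyState_le_one hc.beta_pos hc.beta_lt_one hA'' e
  -- At each level the gain of η'' is at most that of η', which is nonnegative; the weights satisfy
  -- π_η'' ≤ 1 and c ≤ π_η'.
  calc _ ≤ c * (steadyState β η'' e * ((m.g (η' e) - rootLevel m β lam η e * η' e) -
          (m.g (η e) - rootLevel m β lam η e * η e))) := by gcongr
    _ ≤ c * (1 * ((m.g (η' e) - rootLevel m β lam η e * η' e) -
          (m.g (η e) - rootLevel m β lam η e * η e))) := by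
        gcongr
    _ ≤ _ := by
        rw [one_mul]
        exact mul_le_mul_of_nonneg_right (hcle e) (sub_nonneg.2 h2)

/-- At a fixed point of the policy improvement step the clipping is inactive. -/
lemma Regular.slope_eq_rootLevel (hc : ClipBounds m β lam xs ηL ηH) (hN : 1 ≤ N)
    (h : Regular ηL ηH η) (hi : Improves m β lam ηL ηH η η) {e : Fin (N + 1)} (he : e ≠ 0) :
    m.slope (η e) = rootLevel m β lam η e := by
  have hA := h.admissible hc hN
  have hv := isRelativeValue_relValue m (lam := lam) hc.beta_pos hc.beta_lt_one hA
  have hrel := ((isRelativeValue_iff m hA).1 hv).2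
  have hroot := hv.rootLevel_eq m hc.beta_pos hA
  set v := relValue m β lam η
  have hZ := Z_le hc hA
  have hLm := hc.mem_Ioc hc.low_mem
  have hHm := hc.mem_Ioc hc.high_mem
  -- On e > 0, x is largest at level 1. If the lower clip acted there, evaluation at levels 0 and 1
  -- would give (1 - ηL)(x(1) - λ) = Z/β - z(ηL). The equation for ηL has s(ηL) for x(1) and the
  -- upper bound z(min{x*, β}) for Z, so x(1) ≤ s(ηL), a contradiction.
  have hlow : rootLevel m β lam η e ≤ m.slope ηL := by
    obtain ⟨n, rfl⟩ : ∃ n, N = n + 1 := ⟨N - 1, by omega⟩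
    have h1 : (0 : Fin (n + 1)).succ ≠ 0 := Fin.succ_ne_zero _
    have h1e : (0 : Fin (n + 1)).succ ≤ e := by
      rw [Fin.le_def, Fin.val_succ]
      have : (e : ℕ) ≠ 0 := fun h => he (Fin.ext h)
      simp only [Fin.val_zero]
      omega
    refine (h.rootLevel_antitone hc hN h1 h1e).trans ?_
    obtain ⟨u, hu, hclip⟩ := hi.2 _ h1
    rw [← hu.2]
    show m.slope u ≤ m.slope ηL
    rw [m.slope_strictAntiOn.le_iff_ge hu.1 hLm]
    by_contra hlt
    rw [not_le] at hlt
    have hLe : η (0 : Fin (n + 1)).succ = ηL := by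
      rw [hclip, clip, if_neg (not_lt.2 (hlt.le.trans hc.low_lt_high.le)), if_pos hlt]
    have hslope := m.slope_strictAntiOn hu.1 hLm hlt
    have hr0 := hrel 0
    have hr1 := hrel (0 : Fin (n + 1)).succ
    have hd : downDiff v (0 : Fin (n + 1)).succ = upDiff v 0 := by
      rw [downDiff_succ, ← upDiff_castSucc, Fin.castSucc_zero]
    have hX : m.slope u = lam + β * upDiff v (0 : Fin (n + 1)).succ + (1 - β) * upDiff v 0 := by
      rw [← hd, ← hroot]
      exact hu.2
    rw [h.zero, m.z_zero] at hr0
    rw [hd, hLe] at hr1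
    have hu0 : upDiff v 0 = Z m β lam η / β := by
      rw [eq_div_iff hc.beta_pos.ne']
      linarith
    have hw : (1 - ηL) * (m.slope u - lam) = Z m β lam η / β - m.z lam ηL := by
      have hb : Z m β lam η = β * (Z m β lam η / β) := by
        field_simp [hc.beta_pos.ne']
      rw [hu0] at hX hr1
      rw [hX]
      linear_combination hr1 + hb
    have h2 := mul_lt_mul_of_pos_left (sub_lt_sub_right hslope lam)
      (sub_pos.2 (hc.low_lt_high.trans hc.high_lt_one))
    have h3 := hc.low_eq
    have h4 := div_le_div_of_nonneg_right hZ hc.beta_pos.le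
    linarith
  -- Dually, x is smallest at the full battery. The upper clip there would give ηH(x(N) - λ) = z(ηH)
  -- - Z, to be compared with the equation for ηH.
  have hhigh : m.slope ηH ≤ rootLevel m β lam η e := by
    refine le_trans ?_ (h.rootLevel_antitone hc hN he (Fin.le_last e))
    have hl := last_ne_zero_of_one_le hN
    obtain ⟨u, hu, hclip⟩ := hi.2 _ hl
    rw [← hu.2]
    show m.slope ηH ≤ m.slope u
    rw [m.slope_strictAntiOn.le_iff_ge hHm hu.1]
    by_contra hlt
    rw [not_le] at hlt
    have hHe : η (Fin.last N) = ηH := by rw [hclip, clip, if_pos hlt]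
    have hslope := m.slope_strictAntiOn hHm hu.1 hlt
    have hr1 := hrel (Fin.last N)
    have hX : m.slope u = lam + (1 - β) * downDiff v (Fin.last N) := by
      have h1 := hroot (Fin.last N)
      rw [upDiff_last, mul_zero, add_zero] at h1
      rw [← h1]
      exact hu.2
    rw [upDiff_last, hHe] at hr1
    have hw : ηH * (m.slope u - lam) = m.z lam ηH - Z m β lam η := by
      rw [hX]
      linarith
    have h2 := mul_lt_mul_of_pos_left (sub_lt_sub_right hslope lam) hHm.1
    have h3 := hc.high_eq
    linarith
  obtain ⟨u, hu, hclip⟩ := hi.2 e he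
  have hus : m.slope u = rootLevel m β lam η e := hu.2
  rw [← hus] at hlow hhigh ⊢
  rw [m.slope_strictAntiOn.le_iff_ge hu.1 hLm] at hlow
  rw [m.slope_strictAntiOn.le_iff_ge hHm hu.1] at hhigh
  rw [hclip, clip, if_neg (not_lt.2 hhigh), if_neg (not_lt.2 hlow)]

/-- With clipping inactive, x(e) is a supergradient of g at η(e), so η(e) is optimal over all of [0,
1] and every term of the performance difference is at most zero. -/
lemma Regular.Z_lt_of_fixed (hc : ClipBounds m β lam xs ηL ηH) (hN : 1 ≤ N)
    (h : Regular ηL ηH η) (hi : Improves m β lam ηL ηH η η) (hA' : Admissible η')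
    (hne : η' ≠ η) : Z m β lam η' < Z m β lam η := by
  have hA := h.admissible hc hN
  rw [← sub_neg, Z_sub_Z_eq m hc.beta_pos hc.beta_lt_one hA hA']
  have hpos := steadyState_pos hc.beta_pos hc.beta_lt_one hA'
  have hlt : ∀ e, η' e ≠ η e → (m.g (η' e) - rootLevel m β lam η e * η' e) -
      (m.g (η e) - rootLevel m β lam η e * η e) < 0 := by
    intro e hne
    have he : e ≠ 0 := by
      rintro rfl
      exact hne (hA'.1.trans hA.1.symm)
    have h1 := m.g_lt_tangent (hc.mem_Ioc (h.mem e he)) (hA'.mem_Icc e) hne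
    rw [h.slope_eq_rootLevel hc hN hi he] at h1
    linarith
  obtain ⟨e, he⟩ := Function.ne_iff.1 hne
  calc _ < ∑ _ : Fin (N + 1), (0 : ℝ) := by
        refine Finset.sum_lt_sum (fun f _ => ?_) ⟨e, Finset.mem_univ e,
          mul_neg_of_pos_of_neg (hpos e) (hlt e he)⟩
        by_cases hf : η' f = η f
        · rw [hf]; simp
        · exact (mul_neg_of_pos_of_neg (hpos f) (hlt f hf)).le
    _ = 0 := by simp

/-- A maximizer over the regular policies must be fixed by improvement, since improvement stays in
this set and raises Z unless it changes nothing. -/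
lemma ClipBounds.exists_optimal (hc : ClipBounds m β lam xs ηL ηH) (hN : 1 ≤ N) :
    ∃ ηopt : Policy N, Regular ηL ηH ηopt ∧
      ∀ η, Admissible η → η ≠ ηopt → Z m β lam η < Z m β lam ηopt := by
  obtain ⟨η, hη, hmax⟩ := isCompact_regular.exists_isMaxOn (hc.regular_nonempty (N := N))
    (hc.continuousOn_Z hN)
  have hη : Regular ηL ηH η := hη
  obtain ⟨η', hi⟩ := hη.exists_improves hc hN
  have h := hi.eq_of_Z_le hc hN hη (hmax (hη.improves hc hN hi))
  rw [← h] at hi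
  exact ⟨η, hη, fun η' hA hne => hη.Z_lt_of_fixed hc hN hi hA hne⟩

lemma IsInitial.regular (h : IsInitial ηL ηH η) :
    Regular ηL ηH η := by
  refine ⟨h.1.1, fun e he => Ioo_subset_Icc_self (h.2.1 e he), fun e f hef => ?_⟩
  by_cases he : e = 0
  · rw [he, h.1.1]; exact h.1.nonneg f
  · rcases hef.eq_or_lt with rfl | hlt
    · exact le_rfl
    · exact (h.2.2 e f he hlt).le

lemma IsRun.regular (hc : ClipBounds m β lam xs ηL ηH) (hN : 1 ≤ N) (h : Regular ηL ηH η)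
    {run : ℕ → Policy N} (hr : IsRun m β lam ηL ηH η run) (i : ℕ) : Regular ηL ηH (run i) := by
  induction i with
  | zero => rw [hr.1]; exact h
  | succ i ih => exact ih.improves hc hN (hr.2 i)

lemma IsRun.unique {run run' : ℕ → Policy N} (hr : IsRun m β lam ηL ηH η run)
    (hr' : IsRun m β lam ηL ηH η run') : run' = run := by
  funext i
  induction i with
  | zero => rw [hr.1, hr'.1]
  | succ i ih =>
    have h := hr'.2 i
    rw [ih] at h
    exact h.unique (hr.2 i)

lemma Regular.exists_isRun (hc : ClipBounds m β lam xs ηL ηH) (hN : 1 ≤ N)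
    (h : Regular ηL ηH η) : ∃ run, IsRun m β lam ηL ηH η run := by
  choose step hstep using
    fun η : {η : Policy N // Regular ηL ηH η} => η.2.exists_improves hc hN
  let next : {η : Policy N // Regular ηL ηH η} → {η : Policy N // Regular ηL ηH η} :=
    fun η => ⟨step η, η.2.improves hc hN (hstep η)⟩
  refine ⟨fun i => (next^[i] ⟨η, h⟩).1, rfl, fun i => ?_⟩
  dsimp only
  rw [Function.iterate_succ_apply']
  exact hstep _

lemma IsRun.tendsto_sub (hc : ClipBounds m β lam xs ηL ηH) (hN : 1 ≤ N) (h : Regular ηL ηH η)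
    {run : ℕ → Policy N} (hr : IsRun m β lam ηL ηH η run) :
    Tendsto (fun i => |Z m β lam (run (i + 1)) - Z m β lam (run i)|) atTop (𝓝 0) := by
  have hreg := hr.regular hc hN h
  have hmono : Monotone fun i => Z m β lam (run i) :=
    monotone_nat_of_le_succ fun i => (hr.2 i).Z_le hc hN (hreg i)
  have hbdd : BddAbove (range fun i => Z m β lam (run i)) := by
    refine ⟨m.z lam (min xs β), ?_⟩
    rintro _ ⟨i, rfl⟩
    exact _root_.Z_le hc ((hreg i).admissible hc hN)
  have ht := tendsto_atTop_ciSup hmono hbdd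
  simpa using ((tendsto_add_atTop_iff_nat 1).2 ht |>.sub ht).abs

lemma Regular.existsUnique_returns (hc : ClipBounds m β lam xs ηL ηH) (hN : 1 ≤ N)
    (h : Regular ηL ηH η) {ε : ℝ} (hε : 0 < ε) :
    ∃! out : Policy N, Returns m β lam ηL ηH ε η out := by
  classical
  obtain ⟨run, hr⟩ := h.exists_isRun hc hN
  have hex : ∃ i, |Z m β lam (run (i + 1)) - Z m β lam (run i)| < ε :=
    ((hr.tendsto_sub hc hN h).eventually (gt_mem_nhds hε)).exists
  refine ⟨run (Nat.find hex + 1), ⟨run, Nat.find hex, hr, Nat.find_spec hex,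
    fun j hj => not_lt.1 (Nat.find_min hex hj), rfl⟩, ?_⟩
  rintro _ ⟨run', i, hr', h1, h2, rfl⟩
  obtain rfl := hr.unique hr'
  have hi : Nat.find hex = i :=
    (Nat.find_eq_iff hex).2 ⟨h1, fun j hj => not_lt.2 (h2 j hj)⟩
  rw [hi]

/-- By `Improves.gap_le` a last gain below ε bounds the remaining gap by ε / c, with c independent
of the run; closeness of values then forces closeness of policies. -/
lemma Regular.tendsto_returns (hc : ClipBounds m β lam xs ηL ηH) (hN : 1 ≤ N)
    (h : Regular ηL ηH η) {ηopt : Policy N} (hopt : Regular ηL ηH ηopt)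
    (hmax : ∀ η, Admissible η → η ≠ ηopt → Z m β lam η < Z m β lam ηopt)
    {out : ℝ → Policy N} (hout : ∀ ε > 0, Returns m β lam ηL ηH ε η (out ε)) :
    Tendsto out (𝓝[>] 0) (𝓝 ηopt) := by
  obtain ⟨c, hc0, hcle⟩ := hc.exists_le_steadyState hN
  have hle : ∀ ε > 0, Regular ηL ηH (out ε) ∧
      Z m β lam ηopt - ε / c ≤ Z m β lam (out ε) := by
    intro ε hε
    obtain ⟨run, i, hr, h1, -, h2⟩ := hout ε hε
    have hreg := hr.regular hc hN h
    refine ⟨h2 ▸ hreg (i + 1), ?_⟩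
    have h3 := (hr.2 i).gap_le hc hN (hreg i) hc0 (hcle _ (hreg (i + 1))) hopt
    have h4 : Z m β lam ηopt - Z m β lam (run i) ≤ ε / c := by
      rw [le_div_iff₀ hc0, mul_comm]
      exact h3.trans (le_of_abs_le h1.le)
    have h5 := (hr.2 i).Z_le hc hN (hreg i)
    rw [h2]
    linarith
  have hmem : ∀ᶠ ε in 𝓝[>] (0:ℝ), Regular ηL ηH (out ε) := by
    filter_upwards [self_mem_nhdsWithin] with ε hε using (hle ε hε).1
  refine tendsto_of_isCompact_of_unique_max isCompact_regular (hc.continuousOn_Z hN)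
    (fun η hη hne => hmax η (Regular.admissible hc hN hη) hne) hmem ?_
  have hlim : Tendsto (fun ε => Z m β lam ηopt - ε / c) (𝓝[>] 0) (𝓝 (Z m β lam ηopt)) := by
    have : Continuous fun ε : ℝ => Z m β lam ηopt - ε / c := by fun_prop
    simpa using (this.tendsto 0).mono_left nhdsWithin_le_nhds
  refine tendsto_of_tendsto_of_tendsto_of_le_of_le' hlim tendsto_const_nhds ?_ ?_
  · filter_upwards [self_mem_nhdsWithin] with ε hε using (hle ε hε).2
  · filter_upwards [hmem] with ε hε
    by_cases hne : out ε = ηopt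
    · rw [hne]
    · exact (hmax _ (hε.admissible hc hN) hne).le

end Convergence

end

theorem proposition5 {Ω : Type*} [MeasurableSpace Ω] (μ : Measure Ω) [IsProbabilityMeasure μ]
    (m : SensorModel Ω μ) (N : ℕ) (hN : 1 ≤ N) (β : ℝ) (hβ0 : 0 < β) (hβ1 : β < 1)
    (lam : ℝ) (hlam : 0 ≤ lam) :
    -- the closed form used by the algorithm is the unique invariant distribution
    (∀ η : Policy N, Admissible η → ∀ p, IsInvariantLaw β η p ↔ p = steadyState β η) ∧
    -- the policy evaluation step computes the differences of the relative value function
    (∀ η : Policy N, Admissible η →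
      ∃ v, IsRelativeValue m β lam η v ∧ (∀ w, IsRelativeValue m β lam η w → w = v) ∧
        ∀ e : Fin N, relDiff m β lam η e.succ = v e.succ - v e.castSucc) ∧
    -- the clipping bounds exist and are unique
    ∃ xs ηL ηH : ℝ, IsClipData m β lam xs ηL ηH ∧
      (∀ xs' ηL' ηH', IsClipData m β lam xs' ηL' ηH' → xs' = xs ∧ ηL' = ηL ∧ ηH' = ηH) ∧
      ηL < ηH ∧
      -- the policy improvement step maximizes the one-step look-ahead value
      (∀ η η' v : Policy N, Admissible η → Improves m β lam ηL ηH η η' →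
        IsRelativeValue m β lam η v → ∀ e, e ≠ 0 → η' e ∈ Icc ηL ηH ∧
          ∀ a ∈ Icc ηL ηH, a ≠ η' e →
            m.z lam a + ∑ f, battKernel β a e f * v f <
              m.z lam (η' e) + ∑ f, battKernel β (η' e) e f * v f) ∧
      -- the optimal policy exists and is unique, and the algorithm determines it as `ε → 0`
      ∃ ηopt : Policy N, Admissible ηopt ∧
        (∀ η : Policy N, Admissible η → η ≠ ηopt → Z m β lam η < Z m β lam ηopt) ∧
        ∀ η₀ : Policy N, IsInitial ηL ηH η₀ →
          (∃! run : ℕ → Policy N, IsRun m β lam ηL ηH η₀ run) ∧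
          (∀ run : ℕ → Policy N, IsRun m β lam ηL ηH η₀ run → ∀ i, Admissible (run i) ∧
            ∀ e, e ≠ 0 → ∃! u, IsRoot m β lam (run i) e u) ∧
          (∀ ε > 0, ∃! out : Policy N, Returns m β lam ηL ηH ε η₀ out) ∧
          ∀ out : ℝ → Policy N, (∀ ε > 0, Returns m β lam ηL ηH ε η₀ (out ε)) →
            Tendsto out (𝓝[>] 0) (𝓝 ηopt) := by
  refine ⟨fun η h p => isInvariantLaw_iff hβ0 hβ1 h p,
    fun η h => exists_isRelativeValue m hβ0 hβ1 h, ?_⟩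
  obtain ⟨xs, ηL, ηH, hclip⟩ := exists_isClipData m hβ0 hβ1 hlam
  have hc := hclip.clipBounds m hβ0 hβ1 hlam
  obtain ⟨ηopt, hreg, hmax⟩ := hc.exists_optimal hN
  refine ⟨xs, ηL, ηH, hclip, fun _ _ _ h => hclip.unique m hβ0 hlam h, hc.low_lt_high,
    fun η η' v h hi hv e he => ⟨hi.mem hc he, fun a ha hne => hi.lookAhead_lt hc h hv he ha hne⟩,
    ηopt, hreg.admissible hc hN, hmax, fun η₀ h₀ => ?_⟩
  have hr₀ := h₀.regular
  obtain ⟨run, hrun⟩ := hr₀.exists_isRun hc hN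
  refine ⟨⟨run, hrun, fun run' h' => hrun.unique h'⟩, fun run' h' i => ?_,
    fun ε hε => hr₀.existsUnique_returns hc hN hε,
    fun out hout => hr₀.tendsto_returns hc hN hreg hmax hout⟩
  have hi := h'.regular hc hN hr₀ i
  exact ⟨hi.admissible hc hN, fun e he => existsUnique_isRoot (hi.rootLevel_nonneg hc hN he)⟩
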